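/- Let $k$ be a finite field of characteristic $p\ge 3$. Consider elements $e,h,f,v_0,v_1$ of a Lie algebra over $k$ with the multiplication $$[h,e]=-e+v_1,\ [h,f]=f,\ [e,f]=h,\ [h,v_0]=v_0,\ [h,v_1]=-v_1,\ [e,v_1]=v_0,\ [f,v_0]=v_1,\ [f,v_1]=0,\ [e,v_0]=x,\ [v_0,v_1]=y. \tag{$*$}$$ For $p=3$ and $x=y=0$ this is the multiplication of a $5$-dimensional Lie algebra $L_1$ with basis $(e,h,f,v_0,v_1)$. A $6$-dimensional Lie algebra over $k$ is said to be - of type $C(\alpha,\beta)$ (a central extension of $L_1$) if it has a basis $(e,h,f,v_0,v_1,z)$ with $z$ central and multiplication $(*)$, where $x=\alpha z$, $y=\beta z$; - of type $D_1$ (respectively $D_2$) if it has a basis $(d,e,h,f,v_0,v_1)$ such that $e,h,f,v_0,v_1$ span a $5$-dimensional ideal with multiplication $(*)$, where $x=y=0$, and $[d,e]=v_1$, $[d,h]=[d,f]=[d,v_0]=[d,v_1]=0$ (respectively $[d,f]=v_0$, $[d,e]=[d,h]=[d,v_0]=[d,v_1]=0$). Let $L$ be a nonsolvable Lie algebra of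 dimension $6$ over $k$ with $\dim\operatorname{rad}(L)=3$ for which the extension $$0\to\operatorname{rad}(L)\to L\to L/\operatorname{rad}(L)\to0$$ does not split. Then $p=3$, and $L$ is of one of the types $C(0,0)$, $C(0,1)$, $C(1,0)$, $D_1$, $D_2$. Moreover, for $p=3$, Lie algebras of different types in this list are not isomorphic, and Lie algebras of the types $C(0,0)$, $C(1,0)$, $D_1$, $D_2$ exist over $k$. The type $C(0,1)$ does not in fact occur: no Lie algebra over $k$ is of this type, as its multiplication violates the Jacobi identity. -/

import Mathlib

universe u v w

/-- The extension `0 → rad L → L → L / rad L → 0` splits: the canonical projection has a section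
which is a homomorphism of Lie algebras. -/
def RadicalExtensionSplits (k : Type u) (L : Type v) [Field k] [LieRing L] [LieAlgebra k L] :
    Prop :=
  ∃ s : (L ⧸ LieAlgebra.radical k L) →ₗ⁅k⁆ L,
    ∀ q : L ⧸ LieAlgebra.radical k L, LieSubmodule.Quotient.mk (N := LieAlgebra.radical k L) (s q) = q

/-- The multiplication table on `e, h, f, v₀, v₁`, in which the two brackets `[e, v₀] = x` and
`[v₀, v₁] = y` are left as parameters. For `x = y = 0` (and `e, h, f, v₀, v₁` a basis) this is the
`5`-dimensional algebra `L₁`, a nonsplit extension of `sl(2, k)` by its `2`-dimensional irreducible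
module in characteristic `3`. -/
structure LeviTable {L : Type v} [LieRing L] (e h f v₀ v₁ x y : L) : Prop where
  h_e : ⁅h, e⁆ = -e + v₁
  h_f : ⁅h, f⁆ = f
  e_f : ⁅e, f⁆ = h
  h_v₀ : ⁅h, v₀⁆ = v₀
  h_v₁ : ⁅h, v₁⁆ = -v₁
  e_v₀ : ⁅e, v₀⁆ = x
  e_v₁ : ⁅e, v₁⁆ = v₀
  f_v₀ : ⁅f, v₀⁆ = v₁
  f_v₁ : ⁅f, v₁⁆ = 0
  v₀_v₁ : ⁅v₀, v₁⁆ = y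

/-- `L` has a basis `(e, h, f, v₀, v₁, z)` with `z` central and the above multiplication, where
`[e, v₀] = α z` and `[v₀, v₁] = β z`: a central extension `0 → k z → L → L₁ → 0`. -/
def IsCentralExtensionOfL₁ (k : Type u) (L : Type v) [Field k] [LieRing L] [LieAlgebra k L]
    (α β : k) : Prop :=
  ∃ (e h f v₀ v₁ z : L) (b : Module.Basis (Fin 6) k L), ⇑b = ![e, h, f, v₀, v₁, z] ∧
    LeviTable e h f v₀ v₁ (α • z) (β • z) ∧ (∀ x : L, ⁅z, x⁆ = 0)

/-- `L` has a basis `(d, e, h, f, v₀, v₁)` such that `e, h, f, v₀, v₁` span a `5`-dimensional ideal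
and multiply as in `L₁`, while `[d, e] = α v₁`, `[d, f] = β v₀` and
`[d, h] = [d, v₀] = [d, v₁] = 0`. -/
def IsDerivationExtensionOfL₁ (k : Type u) (L : Type v) [Field k] [LieRing L] [LieAlgebra k L]
    (α β : k) : Prop :=
  ∃ (d e h f v₀ v₁ : L) (b : Module.Basis (Fin 6) k L) (L₁ : LieIdeal k L),
    ⇑b = ![d, e, h, f, v₀, v₁] ∧
    (L₁ : Submodule k L) = Submodule.span k {e, h, f, v₀, v₁} ∧ Module.finrank k L₁ = 5 ∧
    LeviTable e h f v₀ v₁ 0 0 ∧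
    ⁅d, e⁆ = α • v₁ ∧ ⁅d, f⁆ = β • v₀ ∧ ⁅d, h⁆ = 0 ∧ ⁅d, v₀⁆ = 0 ∧ ⁅d, v₁⁆ = 0

/-- Names for the five multiplication tables. -/
inductive TableType
  | central00
  | central01
  | central10
  | deriv1
  | deriv2

/-- `L` is (isomorphic to) the algebra given by the multiplication table `t`. -/
def HasTableType (k : Type u) (L : Type v) [Field k] [LieRing L] [LieAlgebra k L] :
    TableType → Prop
  | .central00 => IsCentralExtensionOfL₁ k L 0 0
  | .central01 => IsCentralExtensionOfL₁ k L 0 1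
  | .central10 => IsCentralExtensionOfL₁ k L 1 0
  | .deriv1 => IsDerivationExtensionOfL₁ k L 1 0
  | .deriv2 => IsDerivationExtensionOfL₁ k L 0 1

/-! Write R for the radical. A nonsolvable algebra of dimension 3 over a finite field of odd
characteristic is sl(2) (`exists_sl2_basis`), so the extension splits as soon as the standard basis
of L/R lifts to elements of L that satisfy the sl(2)-relations exactly. Such a lift is sought
through one layer of ideals inside R at a time.

A one-dimensional layer is a trivial module and never obstructs. Neither does a layer on which the
Casimir element acts by a nonzero scalar, nor, in characteristic 3, one on which e or f acts
injectively: there the kernel of the derivation (ad e)³ or (ad f)³ supplies the lift. Every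
irreducible three-dimensional module is of one of these kinds (`casimir_or_injective`). On the
natural two-dimensional module the Casimir element acts by 3, so an obstruction survives only in
characteristic 3. It has two parameters; a shear changes one of them by t³ times the other, and
since finite fields of characteristic 3 have cube roots, every nonzero obstruction normalises to L₁
(`hasSlLift_or_leviTable`).

Hence in the nonsplit case p = 3 and R has a line and a plane as layers, in one of two orders. With
the line J at the bottom, J is central, and a choice of representatives together with the Jacobi
identity leaves only [e, v₀] free: C(0,0) or C(1,0) (`exists_tableType_of_central`). With the plane
at the bottom, an element d acts on L₁ as a derivation; modulo inner derivations two parameters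
remain, and the shear reduces them to C(0,0), D₁ or D₂ (`exists_tableType_of_derivation`).

The types are told apart by the centre, by perfectness, and by whether the elements x with (ad x)³
inner are closed under the bracket. Models in coordinates give existence, and the Jacobi identity on
h, e, v₀ excludes C(0,1). -/

open Module

/-! ### Nonsolvable Lie algebras of dimension three over a finite field. -/

section ThreeDimensional

/-- Ideals of dimension at most two are metabelian. -/
theorem LieIdeal.derivedSeriesOfIdeal_two_eq_bot {k : Type u} {L : Type v} [Field k] [LieRing L]
    [LieAlgebra k L] (I : LieIdeal k L) {u v : L}
    (hI : ∀ x ∈ I, x ∈ Submodule.span k {u, v}) :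
    LieAlgebra.derivedSeriesOfIdeal k L 2 I = ⊥ := by
  have h1 : ∀ x ∈ I, ∀ y ∈ I, ∃ c : k, ⁅x, y⁆ = c • ⁅u, v⁆ := by
    intro x hx y hy
    obtain ⟨a, b, rfl⟩ := Submodule.mem_span_pair.1 (hI x hx)
    obtain ⟨c, d, rfl⟩ := Submodule.mem_span_pair.1 (hI y hy)
    refine ⟨a * d - b * c, ?_⟩
    simp only [lie_add, add_lie, lie_smul, smul_lie, lie_self]
    rw [← lie_skew u v]
    module
  have h2 : ∀ x ∈ LieAlgebra.derivedSeriesOfIdeal k L 1 I, ∃ c : k, x = c • ⁅u, v⁆ := by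
    intro x hx
    rw [LieAlgebra.derivedSeriesOfIdeal_succ, LieAlgebra.derivedSeriesOfIdeal_zero,
      ← LieSubmodule.mem_toSubmodule, LieSubmodule.lieIdeal_oper_eq_linear_span'] at hx
    have hle : Submodule.span k {x | ∃ y ∈ I, ∃ z ∈ I, ⁅y, z⁆ = x} ≤
        Submodule.span k {⁅u, v⁆} := by
      rw [Submodule.span_le]
      rintro _ ⟨y, hy, z, hz, rfl⟩
      obtain ⟨c, hc⟩ := h1 y hy z hz
      rw [hc]
      exact Submodule.smul_mem _ _ (Submodule.mem_span_singleton_self _)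
    obtain ⟨c, hc⟩ := Submodule.mem_span_singleton.1 (hle hx)
    exact ⟨c, hc.symm⟩
  rw [LieAlgebra.derivedSeriesOfIdeal_succ, LieSubmodule.lie_eq_bot_iff]
  intro x hx y hy
  obtain ⟨c, rfl⟩ := h2 x hx
  obtain ⟨d, rfl⟩ := h2 y hy
  simp

/-- In a nonsolvable Lie algebra of dimension three the brackets of basis vectors are linearly
independent. -/
theorem linearIndependent_brackets_of_not_isSolvable {k : Type u} {S : Type v} [Field k]
    [LieRing S] [LieAlgebra k S] (hns : ¬ LieAlgebra.IsSolvable S) (x : Basis (Fin 3) k S) :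
    LinearIndependent k ![⁅x 1, x 2⁆, ⁅x 2, x 0⁆, ⁅x 0, x 1⁆] := by
  by_contra hli
  apply hns
  set y : Fin 3 → S := ![⁅x 1, x 2⁆, ⁅x 2, x 0⁆, ⁅x 0, x 1⁆] with hy
  have hfin : FiniteDimensional k S := x.finiteDimensional_of_finite
  -- If the brackets are dependent, the derived algebra lies in a space of dimension at most two and
  -- is metabelian.
  have hlt : finrank k (Submodule.span k (Set.range y)) ≤ 2 := by
    by_contra hcon
    apply hli
    rw [linearIndependent_iff_card_eq_finrank_span]
    have := finrank_range_le_card (R := k) y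
    simp only [Fintype.card_fin, Set.finrank] at this ⊢
    omega
  have hD : ∀ z ∈ LieAlgebra.derivedSeriesOfIdeal k S 1 ⊤, z ∈ Submodule.span k (Set.range y) := by
    intro z hz
    rw [LieAlgebra.derivedSeriesOfIdeal_succ, LieAlgebra.derivedSeriesOfIdeal_zero,
      ← LieSubmodule.mem_toSubmodule, LieSubmodule.lieIdeal_oper_eq_linear_span'] at hz
    refine Submodule.span_le.2 ?_ hz
    rintro _ ⟨a, -, b, -, rfl⟩
    have h0 : ⁅x 1, x 2⁆ ∈ Submodule.span k (Set.range y) := Submodule.subset_span ⟨0, rfl⟩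
    have h1 : ⁅x 2, x 0⁆ ∈ Submodule.span k (Set.range y) := Submodule.subset_span ⟨1, rfl⟩
    have h2 : ⁅x 0, x 1⁆ ∈ Submodule.span k (Set.range y) := Submodule.subset_span ⟨2, rfl⟩
    rw [← x.sum_repr a, ← x.sum_repr b, Fin.sum_univ_three, Fin.sum_univ_three]
    generalize x.repr a = a
    generalize x.repr b = b
    have : ⁅a 0 • x 0 + a 1 • x 1 + a 2 • x 2, b 0 • x 0 + b 1 • x 1 + b 2 • x 2⁆ =
        (a 1 * b 2 - a 2 * b 1) • ⁅x 1, x 2⁆ + (a 2 * b 0 - a 0 * b 2) • ⁅x 2, x 0⁆ +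
        (a 0 * b 1 - a 1 * b 0) • ⁅x 0, x 1⁆ := by
      simp only [lie_add, add_lie, lie_smul, smul_lie, lie_self]
      rw [← lie_skew (x 2) (x 1), ← lie_skew (x 0) (x 2), ← lie_skew (x 1) (x 0)]
      module
    rw [SetLike.mem_coe, this]
    exact add_mem (add_mem (Submodule.smul_mem _ _ h0) (Submodule.smul_mem _ _ h1))
      (Submodule.smul_mem _ _ h2)
  obtain ⟨u, v, huv⟩ : ∃ u v : S, Submodule.span k (Set.range y) ≤ Submodule.span k {u, v} := by
    set W := Submodule.span k (Set.range y)
    have hb := Module.finBasis k W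
    obtain ⟨f, hf⟩ : ∃ f : Fin 2 → S, W ≤ Submodule.span k (Set.range f) := by
      -- The value 0 pads a basis of `W` that has fewer than two vectors.
      refine ⟨fun i => if h : (i : ℕ) < finrank k W then (hb ⟨i, h⟩ : S) else 0, ?_⟩
      have := hb.span_eq
      have h3 : W = Submodule.map W.subtype ⊤ := by simp
      refine le_of_eq_of_le h3 ?_
      rw [← this, Submodule.map_span, Submodule.span_le]
      rintro _ ⟨_, ⟨i, rfl⟩, rfl⟩
      apply Submodule.subset_span
      exact ⟨⟨i, by omega⟩, by simp⟩
    refine ⟨f 0, f 1, hf.trans (Submodule.span_mono ?_)⟩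
    rintro _ ⟨i, rfl⟩
    fin_cases i <;> simp
  -- One derivation reaches the space spanned by `u` and `v`; two more annihilate it.
  apply LieAlgebra.IsSolvable.mk (R := k) (k := 2 + 1)
  rw [LieAlgebra.derivedSeries_def, LieAlgebra.derivedSeriesOfIdeal_add]
  exact LieIdeal.derivedSeriesOfIdeal_two_eq_bot _ fun z hz => huv (hD z hz)

/-- A quadratic form in three variables over a finite field has a nontrivial zero. -/
theorem exists_isotropic_ternary {k : Type u} [Field k] [Finite k] (a b c d e f : k) :
    ∃ r s t : k, (r ≠ 0 ∨ s ≠ 0 ∨ t ≠ 0) ∧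
      a * r ^ 2 + b * s ^ 2 + c * t ^ 2 + d * (s * t) + e * (r * t) + f * (r * s) = 0 := by
  classical
  have := Fintype.ofFinite k
  obtain ⟨p, hp⟩ := CharP.exists k
  have hpp : p.Prime := (CharP.char_is_prime_or_zero k p).resolve_right (CharP.char_ne_zero_of_finite k p)
  open MvPolynomial in
  let P : MvPolynomial (Fin 3) k := C a * X 0 ^ 2 + C b * X 1 ^ 2 + C c * X 2 ^ 2 +
    C d * (X 1 * X 2) + C e * (X 0 * X 2) + C f * (X 0 * X 1)
  have h2 : ∀ (x : k) (Q : MvPolynomial (Fin 3) k), Q.totalDegree ≤ 2 →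
      (MvPolynomial.C x * Q).totalDegree ≤ 2 := fun x Q hQ =>
    (MvPolynomial.totalDegree_mul _ _).trans (by simpa using hQ)
  have hmul : ∀ i j : Fin 3, (MvPolynomial.X (R := k) i * MvPolynomial.X j).totalDegree ≤ 2 :=
    fun i j => (MvPolynomial.totalDegree_mul _ _).trans (by simp)
  have hsq : ∀ i : Fin 3, (MvPolynomial.X (R := k) i ^ 2).totalDegree ≤ 2 :=
    fun i => by rw [sq]; exact hmul i i
  have hadd : ∀ Q Q' : MvPolynomial (Fin 3) k, Q.totalDegree ≤ 2 → Q'.totalDegree ≤ 2 →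
      (Q + Q').totalDegree ≤ 2 := fun Q Q' hQ hQ' =>
    (MvPolynomial.totalDegree_add _ _).trans (max_le hQ hQ')
  have hP : P.totalDegree ≤ 2 :=
    hadd _ _ (hadd _ _ (hadd _ _ (hadd _ _ (hadd _ _ (h2 _ _ (hsq _)) (h2 _ _ (hsq _)))
      (h2 _ _ (hsq _))) (h2 _ _ (hmul _ _))) (h2 _ _ (hmul _ _))) (h2 _ _ (hmul _ _))
  -- Chevalley–Warning applies as 2 < 3: the number of zeros is a multiple of p, and the origin is
  -- one of them.
  have hdvd := char_dvd_card_solutions p (f := P) (lt_of_le_of_lt hP (by simp))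
  have h0 : MvPolynomial.eval (0 : Fin 3 → k) P = 0 := by simp [P]
  have hcard : 1 < Fintype.card {x : Fin 3 → k // MvPolynomial.eval x P = 0} :=
    lt_of_lt_of_le hpp.one_lt (Nat.le_of_dvd (Fintype.card_pos_iff.2 ⟨⟨0, h0⟩⟩) hdvd)
  obtain ⟨⟨x, hx⟩, hne⟩ := Fintype.exists_ne_of_one_lt_card hcard ⟨0, h0⟩
  refine ⟨x 0, x 1, x 2, ?_, ?_⟩
  · by_contra! hcon
    apply hne
    ext i
    fin_cases i <;> simp [hcon]
  · simpa [P] using hx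

/-- A three-dimensional nonsolvable Lie algebra over a finite field of odd characteristic is split
of type `A₁`. -/
theorem exists_sl2_basis {k : Type u} [Field k] [Finite k] (h2 : (2 : k) ≠ 0) {S : Type v}
    [LieRing S] [LieAlgebra k S] (hS : finrank k S = 3) (hns : ¬ LieAlgebra.IsSolvable S) :
    ∃ b : Basis (Fin 3) k S, ⁅b 1, b 0⁆ = (2 : k) • b 0 ∧ ⁅b 1, b 2⁆ = -((2 : k) • b 2) ∧
      ⁅b 0, b 2⁆ = b 1 := by
  have hfin : FiniteDimensional k S := FiniteDimensional.of_finrank_pos (by omega)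
  have x : Basis (Fin 3) k S := Module.finBasisOfFinrankEq k S hS
  have hy := linearIndependent_brackets_of_not_isSolvable hns x
  obtain ⟨a, b, c, h12⟩ : ∃ a b c : k, ⁅x 1, x 2⁆ = a • x 0 + b • x 1 + c • x 2 :=
    ⟨_, _, _, by rw [← Fin.sum_univ_three (fun i => x.repr ⁅x 1, x 2⁆ i • x i), x.sum_repr]⟩
  obtain ⟨b', d, g, h20⟩ : ∃ a b c : k, ⁅x 2, x 0⁆ = a • x 0 + b • x 1 + c • x 2 :=
    ⟨_, _, _, by rw [← Fin.sum_univ_three (fun i => x.repr ⁅x 2, x 0⁆ i • x i), x.sum_repr]⟩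
  obtain ⟨c', g', w, h01⟩ : ∃ a b c : k, ⁅x 0, x 1⁆ = a • x 0 + b • x 1 + c • x 2 :=
    ⟨_, _, _, by rw [← Fin.sum_univ_three (fun i => x.repr ⁅x 0, x 1⁆ i • x i), x.sum_repr]⟩
  have hy' : ∀ r s t : k, r • ⁅x 1, x 2⁆ + s • ⁅x 2, x 0⁆ + t • ⁅x 0, x 1⁆ = 0 →
      r = 0 ∧ s = 0 ∧ t = 0 := by
    intro r s t hrst
    have := Fintype.linearIndependent_iff.1 hy ![r, s, t] (by simpa [Fin.sum_univ_three] using hrst)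
    exact ⟨this 0, this 1, this 2⟩
  -- The Jacobi identity on the basis says exactly that the matrix of structure constants is
  -- symmetric.
  obtain ⟨e1, e2, e3⟩ : g - g' = 0 ∧ c' - c = 0 ∧ b - b' = 0 := by
    apply hy'
    have hj := lie_jacobi (x 0) (x 1) (x 2)
    rw [h12, h20, h01] at hj
    simp only [lie_add, lie_smul, lie_self] at hj
    rw [← lie_skew (x 0) (x 2), ← lie_skew (x 1) (x 0), ← lie_skew (x 2) (x 1)] at hj
    rw [← hj]
    module
  obtain rfl : g' = g := (sub_eq_zero.1 e1).symm
  obtain rfl : c' = c := sub_eq_zero.1 e2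
  obtain rfl : b' = b := (sub_eq_zero.1 e3).symm
  let X : k → k → k → S := fun r s t => r • x 0 + s • x 1 + t • x 2
  have hX0 : ∀ r s t : k, X r s t = 0 → r = 0 ∧ s = 0 ∧ t = 0 := by
    intro r s t hrst
    have := Fintype.linearIndependent_iff.1 x.linearIndependent ![r, s, t]
      (by simpa [Fin.sum_univ_three] using hrst)
    exact ⟨this 0, this 1, this 2⟩
  have hbr : ∀ r s t r' s' t' : k, ⁅X r s t, X r' s' t'⁆ =
      X (a * (s * t' - t * s') + b' * (t * r' - r * t') + c' * (r * s' - s * r'))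
        (b' * (s * t' - t * s') + d * (t * r' - r * t') + g' * (r * s' - s * r'))
        (c' * (s * t' - t * s') + g' * (t * r' - r * t') + w * (r * s' - s * r')) := by
    intro r s t r' s' t'
    simp only [X, lie_add, add_lie, lie_smul, smul_lie, lie_self]
    rw [← lie_skew (x 2) (x 1), ← lie_skew (x 0) (x 2), ← lie_skew (x 1) (x 0), h12, h20, h01]
    module
  have hdet : a * (d * w - g' ^ 2) + b' * (c' * g' - b' * w) + c' * (b' * g' - c' * d) ≠ 0 := by
    intro hdet
    have : (!![a, b', c'; b', d, g'; c', g', w] : Matrix (Fin 3) (Fin 3) k).det = 0 := by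
      rw [Matrix.det_fin_three]
      simp
      linear_combination hdet
    obtain ⟨v, hv, hv0⟩ := Matrix.exists_mulVec_eq_zero_iff.2 this
    have h0 := congrFun hv0 0
    have h1 := congrFun hv0 1
    have h3 := congrFun hv0 2
    simp [Matrix.mulVec, dotProduct, Fin.sum_univ_three] at h0 h1 h3
    obtain ⟨q0, q1, q2⟩ := hy' (v 0) (v 1) (v 2) (by
      rw [h12, h20, h01]
      linear_combination (norm := module) h0 • x 0 + h1 • x 1 + h3 • x 2)
    apply hv
    ext i
    fin_cases i <;> simp [q0, q1, q2]
  -- `B` is the symmetric bilinear form of the adjugate of the structure matrix. The identity `hB`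
  -- generalises the vector triple product; for isotropic u it reads (ad u)² v = B(u, v) u.
  let B : k → k → k → k → k → k → k := fun r s t r' s' t' =>
    r' * ((d * w - g' ^ 2) * r + (c' * g' - b' * w) * s + (b' * g' - c' * d) * t) +
    s' * ((c' * g' - b' * w) * r + (a * w - c' ^ 2) * s + (b' * c' - a * g') * t) +
    t' * ((b' * g' - c' * d) * r + (b' * c' - a * g') * s + (a * d - b' ^ 2) * t)
  have hB : ∀ r s t r' s' t' : k, ⁅X r s t, ⁅X r s t, X r' s' t'⁆⁆ =
      B r s t r' s' t' • X r s t - B r s t r s t • X r' s' t' := by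
    intro r s t r' s' t'
    rw [hbr, hbr]
    simp only [X, B]
    module
  obtain ⟨r, s, t, hne, hiso⟩ := exists_isotropic_ternary (d * w - g' ^ 2) (a * w - c' ^ 2)
    (a * d - b' ^ 2) (2 * (b' * c' - a * g')) (2 * (b' * g' - c' * d)) (2 * (c' * g' - b' * w))
  have hiso' : B r s t r s t = 0 := by simp only [B]; linear_combination hiso
  -- The value -2 makes [u, v] act on u with eigenvalue 2. It is attained because `B` is
  -- nondegenerate: the structure matrix times its adjugate is the determinant.
  obtain ⟨r', s', t', hv⟩ : ∃ r' s' t' : k, B r s t r' s' t' = -2 := by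
    by_contra! hcon
    have h0 : (d * w - g' ^ 2) * r + (c' * g' - b' * w) * s + (b' * g' - c' * d) * t = 0 := by
      by_contra h
      exact hcon (-2 / _) 0 0 (by simp only [B]; rw [div_mul_cancel₀ _ h]; ring)
    have h1 : (c' * g' - b' * w) * r + (a * w - c' ^ 2) * s + (b' * c' - a * g') * t = 0 := by
      by_contra h
      exact hcon 0 (-2 / _) 0 (by simp only [B]; rw [div_mul_cancel₀ _ h]; ring)
    have h3 : (b' * g' - c' * d) * r + (b' * c' - a * g') * s + (a * d - b' ^ 2) * t = 0 := by
      by_contra h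
      exact hcon 0 0 (-2 / _) (by simp only [B]; rw [div_mul_cancel₀ _ h]; ring)
    have q0 : r = 0 := (mul_eq_zero.1 (show _ * r = 0 by
      linear_combination a * h0 + b' * h1 + c' * h3)).resolve_left hdet
    have q1 : s = 0 := (mul_eq_zero.1 (show _ * s = 0 by
      linear_combination b' * h0 + d * h1 + g' * h3)).resolve_left hdet
    have q2 : t = 0 := (mul_eq_zero.1 (show _ * t = 0 by
      linear_combination c' * h0 + g' * h1 + w * h3)).resolve_left hdet
    simp [q0, q1, q2] at hne
  have hv' : B r' s' t' r s t = -2 := by rw [← hv]; simp only [B]; ring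
  have hu : X r s t ≠ 0 := by
    intro h
    obtain ⟨q0, q1, q2⟩ := hX0 _ _ _ h
    simp [q0, q1, q2] at hne
  have huv := hB r s t r' s' t'
  have hvu := hB r' s' t' r s t
  rw [hiso', hv, zero_smul, sub_zero] at huv
  rw [hv'] at hvu
  generalize X r s t = u at hu huv hvu
  generalize X r' s' t' = v at huv hvu
  generalize B r' s' t' r' s' t' = q at hvu
  have h4 : (4 : k) ≠ 0 := by
    rw [show (4 : k) = 2 * 2 by norm_num]
    exact mul_ne_zero h2 h2
  have r1 : ⁅⁅u, v⁆, u⁆ = (2 : k) • u := by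
    rw [← lie_skew, huv]
    module
  -- By `hvu`, [[u, v], v] = -2v - q u; adding (q/4) u to v turns it into an eigenvector.
  have r2 : ⁅⁅u, v⁆, v + (q / 4) • u⁆ = -((2 : k) • (v + (q / 4) • u)) := by
    have : ⁅⁅u, v⁆, v⁆ = ⁅v, ⁅v, u⁆⁆ := by
      rw [← lie_skew _ v, ← lie_skew v u, lie_neg]
    rw [lie_add, lie_smul, r1, this, hvu]
    match_scalars <;> field_simp
    ring
  have r3 : ⁅u, v + (q / 4) • u⁆ = ⁅u, v⁆ := by simp
  have hli : LinearIndependent k ![u, ⁅u, v⁆, v + (q / 4) • u] := by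
    rw [Fintype.linearIndependent_iff]
    intro z hz
    simp only [Fin.sum_univ_three, Matrix.cons_val] at hz
    have z1 : ⁅u, z 0 • u + z 1 • ⁅u, v⁆ + z 2 • (v + (q / 4) • u)⁆ = 0 := by rw [hz, lie_zero]
    rw [lie_add, lie_add, lie_smul, lie_smul, lie_smul, r3, huv, lie_self] at z1
    have z2 : ⁅u, z 0 • (0 : S) + z 1 • (-2 : k) • u + z 2 • ⁅u, v⁆⁆ = 0 := by rw [z1, lie_zero]
    rw [lie_add, lie_add, lie_smul, lie_smul, lie_smul, lie_smul, huv, lie_self, lie_zero] at z2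
    have q2 : z 2 = 0 := by simpa [h2, hu] using z2
    have q1 : z 1 = 0 := by simpa [h2, hu, q2] using z1
    have q0 : z 0 = 0 := by simpa [hu, q1, q2] using hz
    intro i
    fin_cases i <;> assumption
  refine ⟨basisOfLinearIndependentOfCardEqFinrank hli (by simp [hS]), ?_⟩
  simp only [coe_basisOfLinearIndependentOfCardEqFinrank, Matrix.cons_val]
  exact ⟨r1, r2, r3⟩

end ThreeDimensional

/-! ### Representations of sl(2) of dimension two and three. -/

section SlAction

/-- Three endomorphisms satisfying the relations of the standard basis `e, h, f` of `sl(2)`. -/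
structure SlAction {k : Type u} {V : Type v} [Field k] [AddCommGroup V] [Module k V]
    (e h f : V →ₗ[k] V) : Prop where
  h_e : ∀ m, h (e m) = e (h m) + (2 : k) • e m
  h_f : ∀ m, h (f m) = f (h m) - (2 : k) • f m
  e_f : ∀ m, e (f m) = f (e m) + h m

variable {k : Type u} {V : Type v} [Field k] [AddCommGroup V] [Module k V] {e h f : V →ₗ[k] V}

namespace SlAction

theorem eq_zero_of_e_eq_zero (H : SlAction e h f) (h2 : (2 : k) ≠ 0) (he : e = 0) :
    h = 0 ∧ f = 0 := by
  have hh : h = 0 := by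
    ext m
    have := H.e_f m
    simpa [he] using this.symm
  refine ⟨hh, ?_⟩
  ext m
  have := H.h_f m
  simpa [hh, h2] using this

/-- If `e` is injective then the trace of `[h, e] e⁻¹ = 2` vanishes. -/
theorem two_mul_finrank_eq_zero [FiniteDimensional k V] (H : SlAction e h f)
    (he : Function.Injective e) : (2 : k) * (finrank k V : k) = 0 := by
  let E := LinearEquiv.ofInjectiveEndo e he
  have hE : ∀ m, e (E.symm m) = m := fun m => E.apply_symm_apply m
  have key : h = E.conj h + (2 : k) • LinearMap.id := by
    ext m
    have := H.h_e (E.symm m)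
    rw [hE] at this
    rw [this]
    rfl
  have htr := congrArg (LinearMap.trace k V) key
  rw [map_add, LinearMap.trace_conj', map_smul, LinearMap.trace_id] at htr
  simpa using htr

/-- On a common eigenvector of e and h the commutator [h, e] = 2e vanishes. -/
theorem e_apply_eq_zero_of_eigen (H : SlAction e h f) (h2 : (2 : k) ≠ 0) {w : V} {c d : k}
    (hw : h w = c • w) (ew : e w = d • w) : e w = 0 := by
  have := H.h_e w
  rw [ew, map_smul, hw, map_smul, ew] at this
  have h3 : (2 * d) • w = 0 := by
    linear_combination (norm := module) -this
  rw [ew]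
  rcases smul_eq_zero.1 h3 with h4 | h4
  · rw [(mul_eq_zero.1 h4).resolve_left h2, zero_smul]
  · rw [h4, smul_zero]

theorem exists_eigen_of_finrank_eq_one {W : Submodule k V} (hW : finrank k W = 1)
    (g : V →ₗ[k] V) (hg : ∀ m ∈ W, g m ∈ W) : ∃ w ∈ W, w ≠ 0 ∧ (∀ m ∈ W, ∃ c : k, m = c • w) ∧
      ∃ c : k, g w = c • w := by
  obtain ⟨⟨w, hw⟩, hw0, hs⟩ := finrank_eq_one_iff'.1 hW
  have : ∀ m ∈ W, ∃ c : k, m = c • w := by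
    intro m hm
    obtain ⟨c, hc⟩ := hs ⟨m, hm⟩
    exact ⟨c, (congrArg Subtype.val hc).symm⟩
  exact ⟨w, hw, fun h => hw0 (Subtype.ext h), this, this _ (hg w hw)⟩

/-- A primitive vector exists as soon as the kernel or the range of `e` is a line. -/
theorem exists_primitive (H : SlAction e h f) (h2 : (2 : k) ≠ 0)
    (hfin : finrank k (LinearMap.ker e) = 1 ∨ finrank k (LinearMap.range e) = 1) :
    ∃ (w : V) (c : k), w ≠ 0 ∧ e w = 0 ∧ h w = c • w := by
  rcases hfin with hfin | hfin
  · obtain ⟨w, hw, hw0, -, c, hc⟩ := exists_eigen_of_finrank_eq_one hfin h (by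
      intro m hm
      rw [LinearMap.mem_ker] at hm ⊢
      have := H.h_e m
      rw [hm, map_zero, smul_zero, add_zero] at this
      exact this.symm)
    exact ⟨w, c, hw0, hw, hc⟩
  · obtain ⟨w, hw, hw0, hs, c, hc⟩ := exists_eigen_of_finrank_eq_one hfin h (by
      rintro _ ⟨m, rfl⟩
      exact ⟨h m + (2 : k) • m, by rw [map_add, map_smul, H.h_e]⟩)
    obtain ⟨d, hd⟩ := hs (e w) ⟨w, rfl⟩
    exact ⟨w, c, hw0, H.e_apply_eq_zero_of_eigen h2 hc hd, hc⟩

theorem exists_notMem_span_of_finrank_two (hV : finrank k V = 2) (w : V) :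
    ∃ u : V, u ∉ Submodule.span k {w} := by
  by_contra! hcon
  have htop : Submodule.span k {w} = ⊤ := (Submodule.eq_top_iff').2 hcon
  have := finrank_span_le_card (R := k) ({w} : Set V)
  rw [htop, finrank_top, hV] at this
  simp at this

theorem exists_coord_of_finrank_two (hV : finrank k V = 2) {w u : V} (hw : w ≠ 0)
    (hu : u ∉ Submodule.span k {w}) (m : V) : ∃ a b : k, m = a • w + b • u := by
  have hfin : FiniteDimensional k V := FiniteDimensional.of_finrank_pos (by omega)
  have hli : LinearIndependent k ![w, u] := by
    rw [LinearIndependent.pair_iff' hw]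
    intro a ha
    exact hu (Submodule.mem_span_singleton.2 ⟨a, ha⟩)
  have hspan := hli.span_eq_top_of_card_eq_finrank' (by simp [hV])
  have hm : m ∈ Submodule.span k (Set.range ![w, u]) := hspan ▸ Submodule.mem_top
  rw [Matrix.range_cons, Matrix.range_cons, Matrix.range_empty, Set.union_empty,
    Set.singleton_union] at hm
  obtain ⟨a, b, hab⟩ := Submodule.mem_span_pair.1 hm
  exact ⟨a, b, hab.symm⟩

/-- A nontrivial two-dimensional module is the natural module. -/
theorem exists_natural_basis (H : SlAction e h f) (h2 : (2 : k) ≠ 0) (hV : finrank k V = 2)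
    (he : e ≠ 0) : ∃ v₀ v₁ : V, v₀ ≠ 0 ∧ (∀ m, ∃ a b : k, m = a • v₀ + b • v₁) ∧
      h v₀ = v₀ ∧ h v₁ = -v₁ ∧ e v₀ = 0 ∧ e v₁ = v₀ ∧ f v₀ = v₁ ∧ f v₁ = 0 := by
  have hfin : FiniteDimensional k V := FiniteDimensional.of_finrank_pos (by omega)
  have hinj : ¬ Function.Injective e := by
    intro hinj
    have := H.two_mul_finrank_eq_zero hinj
    rw [hV] at this
    simp [h2] at this
  have hk0 : LinearMap.ker e ≠ ⊥ := fun hk => hinj (LinearMap.ker_eq_bot.1 hk)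
  have hr0 : LinearMap.range e ≠ ⊥ := fun hr => he (LinearMap.range_eq_bot.1 hr)
  have hrk := LinearMap.finrank_range_add_finrank_ker e
  have hk1 := Submodule.one_le_finrank_iff.2 hk0
  have hr1 := Submodule.one_le_finrank_iff.2 hr0
  have hk : finrank k (LinearMap.ker e) = 1 := by omega
  obtain ⟨w, c, hw0, ew, hw⟩ := H.exists_primitive h2 (Or.inl hk)
  have hker : ∀ m, e m = 0 → ∃ a : k, m = a • w := by
    intro m hm
    obtain ⟨⟨z, hz⟩, -, hs⟩ := finrank_eq_one_iff'.1 hk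
    obtain ⟨a, ha⟩ := hs ⟨m, hm⟩
    obtain ⟨b, hb⟩ := hs ⟨w, ew⟩
    have ha' : a • z = m := congrArg Subtype.val ha
    have hb' : b • z = w := congrArg Subtype.val hb
    have hb0 : b ≠ 0 := by rintro rfl; exact hw0 (by rw [← hb', zero_smul])
    exact ⟨a / b, by rw [← ha', ← hb', smul_smul, div_mul_cancel₀ _ hb0]⟩
  -- Otherwise h w = [e, f] w = 0 and then f w = 0, so w spans a trivial submodule; the relations on
  -- a complement `u` then force e = 0.
  have hfw : f w ∉ Submodule.span k {w} := by
    intro hmem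
    obtain ⟨d, hd⟩ := Submodule.mem_span_singleton.1 hmem
    have hhw : h w = 0 := by
      have := H.e_f w
      rw [← hd, map_smul, ew, map_zero, smul_zero, zero_add] at this
      exact this.symm
    have hfw0 : f w = 0 := by
      have := H.h_f w
      rw [hhw, map_zero, zero_sub, ← hd, map_smul, hhw, smul_zero, hd] at this
      simpa [h2] using this.symm
    obtain ⟨u, hu⟩ := exists_notMem_span_of_finrank_two hV w
    have hspan := exists_coord_of_finrank_two hV hw0 hu
    have hf' : ∀ m, ∃ b : k, f m = b • f u := by
      intro m
      obtain ⟨a, b, rfl⟩ := hspan m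
      exact ⟨b, by rw [map_add, map_smul, hfw0, map_smul, smul_zero, zero_add]⟩
    have heu : ∀ m, ∃ b : k, e m = b • e u := by
      intro m
      obtain ⟨a, b, rfl⟩ := hspan m
      exact ⟨b, by rw [map_add, map_smul, ew, map_smul, smul_zero, zero_add]⟩
    have heeu : e (e u) = 0 := by
      obtain ⟨b, hb⟩ := heu (e u)
      refine H.e_apply_eq_zero_of_eigen (c := ?_) h2 ?_ hb
      · exact (heu (h u + (2 : k) • u)).choose
      · rw [H.h_e, ← map_smul, ← map_add]
        exact (heu (h u + (2 : k) • u)).choose_spec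
    obtain ⟨a, ha⟩ := hker _ heeu
    obtain ⟨x, y, hxy⟩ := hspan (f u)
    have hhu : h u = (y * a) • w := by
      have := H.e_f u
      rw [hxy, map_add, map_smul, map_smul, ew, smul_zero, zero_add, ha, map_smul, hfw0,
        smul_zero, zero_add] at this
      rw [← this, smul_smul]
    have := H.h_e u
    rw [ha, map_smul, hhw, hhu, map_smul, ew] at this
    have ha0 : (2 * a) • w = 0 := by
      linear_combination (norm := module) -this
    have ha1 : a = 0 := by simpa [h2, hw0] using ha0
    apply he
    ext m
    obtain ⟨b, hb⟩ := heu m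
    rw [hb, ha, ha1]
    simp
  have hspan := exists_coord_of_finrank_two hV hw0 hfw
  have hhf : h (f w) = (c - 2) • f w := by
    rw [H.h_f, hw, map_smul]; module
  have hef : e (f w) = c • w := by
    rw [H.e_f, ew, map_zero, zero_add, hw]
  obtain ⟨x, y, hxy⟩ := hspan (f (f w))
  have hli : ∀ a b : k, a • w + b • f w = 0 → a = 0 ∧ b = 0 := by
    intro a b hab
    have hb : b = 0 := by
      by_contra hb
      refine hfw (Submodule.mem_span_singleton.2 ⟨-a / b, ?_⟩)
      have : b • ((-a / b) • w) = b • f w := by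
        rw [smul_smul, mul_div_cancel₀ _ hb]
        linear_combination (norm := module) -hab
      exact smul_right_injective _ hb this
    subst hb
    simpa [hw0] using hab
  have hff := H.h_f (f w)
  rw [hxy, hhf, map_add, map_smul, map_smul, hhf, map_smul, hxy, hw] at hff
  -- f² w has weight c - 4, which differs from the weights c and c - 2 of the basis by 4 and 2;
  -- hence f² w = 0.
  obtain ⟨hx, hy⟩ := hli (2 * 2 * x) (2 * y) (by linear_combination (norm := module) hff)
  have hx : x = 0 := by simpa [h2] using hx
  have hy : y = 0 := by simpa [h2] using hy
  rw [hx, hy, zero_smul, zero_smul, zero_add] at hxy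
  have hc : c = 1 := by
    have := H.e_f (f w)
    rw [hxy, map_zero, hef, map_smul, hhf] at this
    have := (hli 0 (2 * (c - 1)) (by linear_combination (norm := module) -this)).2
    exact sub_eq_zero.1 (by simpa [h2] using this)
  subst hc
  refine ⟨w, f w, hw0, hspan, ?_, ?_, ew, ?_, rfl, hxy⟩
  · rw [hw, one_smul]
  · rw [hhf]; module
  · rw [hef, one_smul]

/-- The Casimir endomorphism commutes with the action. -/
theorem casimir_comm (H : SlAction e h f) (m : V) :
    h (h (f m)) + (2 : k) • e (f (f m)) + (2 : k) • f (e (f m)) =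
      f (h (h m) + (2 : k) • e (f m) + (2 : k) • f (e m)) := by
  simp only [H.h_f, H.e_f, map_add, map_sub, map_smul]
  module

/-- In an irreducible three-dimensional module some standard central element of the enveloping
algebra acts invertibly. -/
theorem casimir_or_injective (H : SlAction e h f) {p : ℕ} [CharP k p] (hp : 3 ≤ p)
    (hV : finrank k V = 3)
    (hirr : ∀ W : Submodule k V, (∀ m ∈ W, e m ∈ W) → (∀ m ∈ W, h m ∈ W) → (∀ m ∈ W, f m ∈ W) →
      W = ⊥ ∨ W = ⊤) :
    (p = 3 ∧ (Function.Injective e ∨ Function.Injective f)) ∨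
    ∃ c : k, c ≠ 0 ∧ ∀ m, h (h m) + (2 : k) • e (f m) + (2 : k) • f (e m) = c • m := by
  have hfin : FiniteDimensional k V := FiniteDimensional.of_finrank_pos (by omega)
  have hpp : p.Prime := (CharP.char_is_prime_or_zero k p).resolve_right (by omega)
  have h2 : (2 : k) ≠ 0 := by
    intro h
    have := (CharP.cast_eq_zero_iff k p 2).1 (by exact_mod_cast h)
    exact absurd (Nat.le_of_dvd (by norm_num) this) (by omega)
  have h3 : (3 : k) = 0 → p = 3 := by
    intro h
    have := (CharP.cast_eq_zero_iff k p 3).1 (by exact_mod_cast h)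
    have := Nat.le_of_dvd (by norm_num) this
    omega
  by_cases hinj : Function.Injective e
  · left
    refine ⟨h3 ?_, Or.inl hinj⟩
    have := H.two_mul_finrank_eq_zero hinj
    rw [hV] at this
    simpa [h2] using this
  have hsmall : ∀ W : Submodule k V, W = ⊤ → 3 ≤ finrank k W := by
    rintro W rfl
    rw [finrank_top, hV]
  have he : e ≠ 0 := by
    intro he
    obtain ⟨hh, hf⟩ := H.eq_zero_of_e_eq_zero h2 he
    have : Nontrivial V := Module.nontrivial_of_finrank_pos (R := k) (by omega)
    obtain ⟨w, hw⟩ := exists_ne (0 : V)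
    rcases hirr (Submodule.span k {w}) (by simp [he]) (by simp [hh]) (by simp [hf]) with hW | hW
    · exact hw (by simpa using hW)
    · have := hsmall _ hW
      rw [finrank_span_singleton hw] at this
      omega
  have hk0 : LinearMap.ker e ≠ ⊥ := fun hk => hinj (LinearMap.ker_eq_bot.1 hk)
  have hr0 : LinearMap.range e ≠ ⊥ := fun hr => he (LinearMap.range_eq_bot.1 hr)
  have hrk := LinearMap.finrank_range_add_finrank_ker e
  have hk1 := Submodule.one_le_finrank_iff.2 hk0
  have hr1 := Submodule.one_le_finrank_iff.2 hr0
  -- Kernel and range of e are nonzero with dimensions adding up to 3, so one of them is a line.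
  obtain ⟨w, c, hw0, ew, hw⟩ := H.exists_primitive h2 (by omega)
  have hhf : h (f w) = (c - 2) • f w := by rw [H.h_f, hw, map_smul]; module
  have hef : e (f w) = c • w := by rw [H.e_f, ew, map_zero, zero_add, hw]
  have hhff : h (f (f w)) = (c - 4) • f (f w) := by rw [H.h_f, hhf, map_smul]; module
  have heff : e (f (f w)) = (2 * (c - 1)) • f w := by rw [H.e_f, hef, hhf, map_smul]; module
  have hhfff : h (f (f (f w))) = (c - 6) • f (f (f w)) := by rw [H.h_f, hhff, map_smul]; module
  have hefff : e (f (f (f w))) = (3 * (c - 2)) • f (f w) := by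
    rw [H.e_f, heff, hhff, map_smul]; module
  have hinv : ∀ s : Set V, (∀ m ∈ s, e m ∈ Submodule.span k s) →
      (∀ m ∈ s, h m ∈ Submodule.span k s) → (∀ m ∈ s, f m ∈ Submodule.span k s) →
      Submodule.span k s = ⊥ ∨ Submodule.span k s = ⊤ := by
    intro s h1 h2 h3
    have aux : ∀ g : V →ₗ[k] V, (∀ m ∈ s, g m ∈ Submodule.span k s) →
        ∀ m ∈ Submodule.span k s, g m ∈ Submodule.span k s := by
      intro g hg m hm
      exact (Submodule.span_le (p := (Submodule.span k s).comap g)).2 hg hm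
    exact hirr _ (aux e h1) (aux h h2) (aux f h3)
  have hpair : ∀ u v : V, Submodule.span k {u, v} ≠ ⊤ := by
    intro u v htop
    classical
    have h1 := hsmall _ htop
    have h2 := finrank_span_finset_le_card (R := k) ({u, v} : Finset V)
    have h4 : ({u, v} : Finset V).card ≤ 2 := Finset.card_le_two
    rw [Finset.coe_pair] at h2
    simp only [Set.finrank] at h2
    omega
  have hmem1 : ∀ u v : V, u ∈ Submodule.span k {u, v} := fun u v =>
    Submodule.subset_span (by simp)
  have hmem2 : ∀ u v : V, v ∈ Submodule.span k {u, v} := fun u v =>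
    Submodule.subset_span (by simp)
  -- Otherwise w and f w would span a proper nonzero submodule.
  have hff : f (f w) ∉ Submodule.span k {w, f w} := by
    intro hmem
    rcases hinv {w, f w} (by simp [ew, hef, Submodule.smul_mem, hmem1])
      (by simp [hw, hhf, Submodule.smul_mem, hmem1, hmem2]) (by simp [hmem2, hmem]) with h1 | h1
    · have := hmem1 w (f w)
      rw [h1] at this
      exact hw0 (by simpa using this)
    · exact hpair _ _ h1
  have hli : LinearIndependent k ![w, f w, f (f w)] := by
    rw [Fintype.linearIndependent_iff]
    intro z hz
    simp only [Fin.sum_univ_three, Matrix.cons_val] at hz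
    have q2 : z 2 = 0 := by
      by_contra hne
      refine hff (Submodule.mem_span_pair.2 ⟨-z 0 / z 2, -z 1 / z 2, ?_⟩)
      apply smul_right_injective _ hne
      simp only [smul_add, smul_smul, mul_div_cancel₀ _ hne]
      linear_combination (norm := module) -hz
    rw [q2, zero_smul, add_zero] at hz
    have q1 : z 1 = 0 := by
      by_contra hne
      have h1 : f w = (-z 0 / z 1) • w := by
        apply smul_right_injective _ hne
        simp only [smul_smul, mul_div_cancel₀ _ hne]
        linear_combination (norm := module) hz
      apply hff
      rw [h1, map_smul, h1, smul_smul]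
      exact Submodule.smul_mem _ _ (hmem1 _ _)
    have q0 : z 0 = 0 := by simpa [q1, hw0] using hz
    intro i
    fin_cases i <;> assumption
  have hli0 : ∀ x y z : k, x • w + y • f w + z • f (f w) = 0 → x = 0 ∧ y = 0 ∧ z = 0 := by
    intro x y z hxyz
    have := Fintype.linearIndependent_iff.1 hli ![x, y, z]
      (by simpa [Fin.sum_univ_three] using hxyz)
    exact ⟨this 0, this 1, this 2⟩
  have hspan : ∀ m, ∃ x y z : k, m = x • w + y • f w + z • f (f w) := by
    intro m
    let b := basisOfLinearIndependentOfCardEqFinrank hli (by simp [hV])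
    refine ⟨b.repr m 0, b.repr m 1, b.repr m 2, ?_⟩
    conv_lhs => rw [← b.sum_repr m, Fin.sum_univ_three]
    simp [b]
  obtain ⟨x, y, z, hxyz⟩ := hspan (f (f (f w)))
  -- Expanded in the basis, f³ w is sent by e into the span of w and f w, whereas the relations give
  -- e f³ w = 3(c - 2) f² w.
  have hx : (3 * (c - 2) : k) = 0 := by
    rw [hxyz] at hefff hhfff
    rw [map_add, map_add, map_smul, map_smul, map_smul, hw, hhf, hhff] at hhfff
    obtain ⟨-, hy, hz⟩ := hli0 (6 * x) (2 * 2 * y) (2 * z)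
      (by linear_combination (norm := module) hhfff)
    rw [map_add, map_add, map_smul, map_smul, map_smul, ew, hef, heff] at hefff
    have := (hli0 _ _ (3 * (c - 2)) (show (-y * c) • w + (-z * (2 * (c - 1))) • f w + _ = 0 by
      linear_combination (norm := module) -hefff)).2.2
    exact this
  -- On the primitive vector of weight c the Casimir element is c² + 2c; commuting with f, it takes
  -- the same value on the whole basis.
  have hcas : ∀ m, h (h m) + (2 : k) • e (f m) + (2 : k) • f (e m) = (c * (c + 2)) • m := by
    have hw' : h (h w) + (2 : k) • e (f w) + (2 : k) • f (e w) = (c * (c + 2)) • w := by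
      rw [hw, map_smul, hw, hef, ew, map_zero]; module
    have hfw' := H.casimir_comm w
    rw [hw', map_smul] at hfw'
    have hffw' := H.casimir_comm (f w)
    rw [hfw', map_smul] at hffw'
    intro m
    obtain ⟨x, y, z, rfl⟩ := hspan m
    simp only [map_add, map_smul]
    linear_combination (norm := module) x • hw' + y • hfw' + z • hffw'
  by_cases hc : c * (c + 2) = 0
  swap
  · exact Or.inr ⟨_, hc, hcas⟩
  left
  -- The alternative c = 2 would give c(c + 2) = 8, which is nonzero.
  have hp3 : (3 : k) = 0 := by
    rcases mul_eq_zero.1 hx with h | h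
    · exact h
    · exfalso
      have : c = 2 := sub_eq_zero.1 h
      rw [this] at hc
      have h8 : (2 * (2 * 2) : k) = 0 := by linear_combination hc
      simp [h2] at h8
  refine ⟨h3 hp3, Or.inr ?_⟩
  have hy : y = 0 ∧ z = 0 := by
    rw [hxyz] at hhfff
    rw [map_add, map_add, map_smul, map_smul, map_smul, hw, hhf, hhff] at hhfff
    obtain ⟨-, hy, hz⟩ := hli0 (6 * x) (2 * 2 * y) (2 * z)
      (by linear_combination (norm := module) hhfff)
    exact ⟨by simpa [h2] using hy, by simpa [h2] using hz⟩
  rw [hy.1, hy.2, zero_smul, zero_smul, add_zero, add_zero] at hxyz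
  -- If f³ w = 0, there is a proper submodule: the span of f w and f² w when c = 0, the line of f² w
  -- when c = -2 = 1.
  have hx0 : x ≠ 0 := by
    rintro rfl
    rw [zero_smul] at hxyz
    rcases mul_eq_zero.1 hc with h0 | h0
    · rw [h0, zero_smul] at hef
      rcases hinv {f w, f (f w)} (by simp [hef, heff, Submodule.smul_mem, hmem1])
        (by simp [hhf, hhff, Submodule.smul_mem, hmem1, hmem2]) (by simp [hmem2, hxyz]) with h1 | h1
      · have := hmem2 (f w) (f (f w))
        rw [h1, Submodule.mem_bot] at this
        exact hff (this ▸ Submodule.zero_mem _)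
      · exact hpair _ _ h1
    · have hc1 : c - 1 = 0 := by linear_combination h0 - hp3
      rw [hc1, mul_zero, zero_smul] at heff
      rcases hinv {f (f w), f (f w)} (by simp [heff])
        (by simp only [Set.pair_eq_singleton, Set.mem_singleton_iff, forall_eq, hhff]
            exact Submodule.smul_mem _ _ (Submodule.mem_span_singleton_self _))
        (by simp [hxyz]) with h1 | h1
      · have := hmem2 (f (f w)) (f (f w))
        rw [h1, Submodule.mem_bot] at this
        exact hff (this ▸ Submodule.zero_mem _)
      · exact hpair _ _ h1
  -- So f³ is the nonzero scalar x, and f is injective.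
  have hf3 : ∀ m, f (f (f m)) = x • m := by
    intro m
    obtain ⟨a, b, d, rfl⟩ := hspan m
    simp only [map_add, map_smul, hxyz]
    module
  intro m n hmn
  have := hf3 m
  rw [hmn, hf3 n] at this
  exact (smul_right_injective _ hx0 this).symm

end SlAction

end SlAction

/-! ### Lifting the sl(2)-relations through an ideal. -/

section Lifting

variable {k : Type u} {L : Type v} [Field k] [LieRing L] [LieAlgebra k L]

/-- Three elements satisfying the relations of the standard basis `e, h, f` of `sl(2)` modulo the
ideal `I`. -/
structure SlTripleMod (I : LieIdeal k L) (e h f : L) : Prop where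
  h_e : ⁅h, e⁆ - (2 : k) • e ∈ I
  h_f : ⁅h, f⁆ + (2 : k) • f ∈ I
  e_f : ⁅e, f⁆ - h ∈ I

/-- The elements `e, h, f` can be changed by elements of `I` so that they satisfy the relations of
the standard basis of `sl(2)`. -/
def HasSlLift (I : LieIdeal k L) (e h f : L) : Prop :=
  ∃ e' h' f' : L, e' - e ∈ I ∧ h' - h ∈ I ∧ f' - f ∈ I ∧
    ⁅h', e'⁆ = (2 : k) • e' ∧ ⁅h', f'⁆ = -((2 : k) • f') ∧ ⁅e', f'⁆ = h'

namespace SlTripleMod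

variable {I : LieIdeal k L} {e h f : L}

theorem exists_defect (H : SlTripleMod I e h f) : ∃ a ∈ I, ∃ b ∈ I, ∃ g ∈ I,
    ⁅h, e⁆ = (2 : k) • e + a ∧ ⁅h, f⁆ = -((2 : k) • f) + b ∧ ⁅e, f⁆ = h + g :=
  ⟨_, H.h_e, _, H.h_f, _, H.e_f, by abel, by abel, by abel⟩

/-- The symmetry exchanging e and f; it reduces the case of injective f to that of injective e. -/
theorem swap (H : SlTripleMod I e h f) : SlTripleMod I f (-h) e where
  h_e := by
    have := I.neg_mem H.h_f
    rwa [neg_add', ← neg_lie] at this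
  h_f := by
    have := I.neg_mem H.h_e
    rwa [neg_sub', ← neg_lie, sub_neg_eq_add] at this
  e_f := by
    have := I.neg_mem H.e_f
    rwa [neg_sub', lie_skew] at this

theorem lie_h_lie_e (H : SlTripleMod I e h f) (hab : ∀ x ∈ I, ∀ y ∈ I, ⁅x, y⁆ = 0) {m : L}
    (hm : m ∈ I) : ⁅h, ⁅e, m⁆⁆ = ⁅e, ⁅h, m⁆⁆ + (2 : k) • ⁅e, m⁆ := by
  obtain ⟨a, ha, -, -, -, -, h1, -, -⟩ := H.exists_defect
  rw [leibniz_lie, h1, add_lie, hab a ha m hm, smul_lie]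
  abel

theorem lie_h_lie_f (H : SlTripleMod I e h f) (hab : ∀ x ∈ I, ∀ y ∈ I, ⁅x, y⁆ = 0) {m : L}
    (hm : m ∈ I) : ⁅h, ⁅f, m⁆⁆ = ⁅f, ⁅h, m⁆⁆ - (2 : k) • ⁅f, m⁆ := by
  obtain ⟨-, -, b, hb, -, -, -, h1, -⟩ := H.exists_defect
  rw [leibniz_lie, h1, add_lie, hab b hb m hm, neg_lie, smul_lie]
  abel

theorem lie_e_lie_f (H : SlTripleMod I e h f) (hab : ∀ x ∈ I, ∀ y ∈ I, ⁅x, y⁆ = 0) {m : L}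
    (hm : m ∈ I) : ⁅e, ⁅f, m⁆⁆ = ⁅f, ⁅e, m⁆⁆ + ⁅h, m⁆ := by
  obtain ⟨-, -, -, -, g, hg, -, -, h1⟩ := H.exists_defect
  rw [leibniz_lie, h1, add_lie, hab g hg m hm]
  abel

/-- The defects of the relations lie in the abelian ideal and hence act on it as zero, so the ideal
is a genuine sl(2)-module. -/
theorem slAction (H : SlTripleMod I e h f) (hab : ∀ x ∈ I, ∀ y ∈ I, ⁅x, y⁆ = 0) :
    SlAction (LieModule.toEnd k L I e) (LieModule.toEnd k L I h) (LieModule.toEnd k L I f) where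
  h_e m := Subtype.ext (H.lie_h_lie_e hab m.2)
  h_f m := Subtype.ext (H.lie_h_lie_f hab m.2)
  e_f m := Subtype.ext (H.lie_e_lie_f hab m.2)

/-- Extensions by a trivial module split. -/
theorem hasSlLift_of_trivial (H : SlTripleMod I e h f) (h2 : (2 : k) ≠ 0)
    (hab : ∀ x ∈ I, ∀ y ∈ I, ⁅x, y⁆ = 0) (he : ∀ x ∈ I, ⁅e, x⁆ = 0) (hh : ∀ x ∈ I, ⁅h, x⁆ = 0)
    (hf : ∀ x ∈ I, ⁅f, x⁆ = 0) : HasSlLift I e h f := by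
  obtain ⟨a, ha, b, hb, g, hg, h1, h3, h4⟩ := H.exists_defect
  have ge : ⁅g, e⁆ = 0 := by rw [← lie_skew, he g hg, neg_zero]
  have gf : ⁅g, f⁆ = 0 := by rw [← lie_skew, hf g hg, neg_zero]
  have af : ⁅a, f⁆ = 0 := by rw [← lie_skew, hf a ha, neg_zero]
  refine ⟨e + (2 : k)⁻¹ • a, h + g, f - (2 : k)⁻¹ • b, ?_, ?_, ?_, ?_, ?_, ?_⟩
  · simpa using I.smul_mem _ ha
  · simpa using hg
  · simpa using I.smul_mem _ hb
  · simp only [lie_add, add_lie, lie_smul, h1, ge, hab g hg a ha, hh a ha, smul_add, smul_smul,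
      mul_inv_cancel₀ h2, smul_zero, add_zero, one_smul]
  · simp only [lie_sub, add_lie, lie_smul, h3, gf, hab g hg b hb, hh b hb, smul_sub, smul_smul,
      mul_inv_cancel₀ h2, smul_zero, add_zero, one_smul]
    abel
  · simp only [lie_sub, add_lie, lie_smul, smul_lie, h4, af, hab a ha b hb, he b hb, smul_zero,
      add_zero, sub_zero]

/-- Extensions by a module on which the Casimir element acts invertibly split. -/
theorem hasSlLift_of_casimir (H : SlTripleMod I e h f) (hab : ∀ x ∈ I, ∀ y ∈ I, ⁅x, y⁆ = 0)
    {c : k} (hc : c ≠ 0)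
    (hcas : ∀ m ∈ I, ⁅h, ⁅h, m⁆⁆ + (2 : k) • ⁅e, ⁅f, m⁆⁆ + (2 : k) • ⁅f, ⁅e, m⁆⁆ = c • m) :
    HasSlLift I e h f := by
  -- Passing from h to [e, f] changes it by an element of I, which leaves the action on I untouched.
  wlog hef : ⁅e, f⁆ = h generalizing h
  · obtain ⟨a, ha, b, hb, g, hg, h1, h3, h4⟩ := H.exists_defect
    have hI : ∀ m ∈ I, ⁅⁅e, f⁆, m⁆ = ⁅h, m⁆ := fun m hm => by
      rw [h4, add_lie, hab g hg m hm, add_zero]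
    have H' : SlTripleMod I e ⁅e, f⁆ f := by
      refine ⟨?_, ?_, by simp⟩
      · rw [h4, add_lie, h1, add_assoc, add_sub_cancel_left]
        exact I.add_mem ha (lie_mem_left k L I g e hg)
      · rw [h4, add_lie, h3, show -((2 : k) • f) + b + ⁅g, f⁆ + (2 : k) • f = b + ⁅g, f⁆ by abel]
        exact I.add_mem hb (lie_mem_left k L I g f hg)
    obtain ⟨e', h', f', q1, q2, q3, q4⟩ := this H' (fun m hm => by
      rw [hI m hm, hI _ (lie_mem_right k L I h m hm), hcas m hm]) rfl
    refine ⟨e', h', f', q1, ?_, q3, q4⟩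
    have := I.add_mem q2 hg
    rw [h4] at this
    rwa [show h' - h = h' - (h + g) + g by abel]
  obtain ⟨a, ha, b, hb, g, hg, h1, h3, -⟩ := H.exists_defect
  have hm : ∀ x : L, ∀ m ∈ I, ⁅x, m⁆ ∈ I := fun x m hm => lie_mem_right k L I x m hm
  -- This is the cocycle condition on the defect.
  have hba : ⁅e, b⁆ = ⁅f, a⁆ := by
    have := leibniz_lie h e f
    rw [hef, lie_self, h1, h3, lie_add, add_lie, lie_neg, lie_smul, smul_lie, ← lie_skew a f] at this
    linear_combination (norm := module) -this
  have ca := congrArg (c⁻¹ • ·) (hcas a ha)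
  have cb := congrArg (c⁻¹ • ·) (hcas b hb)
  simp only [inv_smul_smul₀ hc] at ca cb
  -- Contracting the defect cocycle ω with the Casimir element gives θ(x) = h·ω(h, x) + 2e·ω(f, x) +
  -- 2f·ω(e, x), whose coboundary is c ω up to sign. The corrections are -c⁻¹ θ, where θ(h) = -2[e,
  -- b] - 2[f, a] = -4[f, a].
  refine ⟨e - c⁻¹ • ⁅h, a⁆, h + (4 * c⁻¹) • ⁅f, a⁆, f - c⁻¹ • ⁅h, b⁆, ?_, ?_, ?_, ?_, ?_, ?_⟩
  · simpa using I.smul_mem _ (hm _ _ ha)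
  · simpa using I.smul_mem _ (hm _ _ ha)
  · simpa using I.smul_mem _ (hm _ _ hb)
  · simp only [lie_sub, add_lie, lie_smul, smul_lie, hab _ (hm f a ha) _ (hm h a ha)]
    rw [← lie_skew ⁅f, a⁆ e, h1]
    linear_combination (norm := module) -ca - (2 * c⁻¹) • H.lie_e_lie_f hab ha
  · simp only [lie_sub, add_lie, lie_smul, smul_lie, hab _ (hm f a ha) _ (hm h b hb)]
    rw [← lie_skew ⁅f, a⁆ f, h3, ← hba]
    linear_combination (norm := module) -cb + (2 * c⁻¹) • H.lie_e_lie_f hab hb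
  · simp only [lie_sub, sub_lie, lie_smul, smul_lie, hab _ (hm h a ha) _ (hm h b hb), hef]
    rw [← lie_skew _ f]
    have e1 := H.lie_h_lie_e hab hb
    have e2 := H.lie_h_lie_f hab ha
    rw [hba] at e1
    linear_combination (norm := module) c⁻¹ • e1 - c⁻¹ • e2

/-- In characteristic three the cube of an inner derivation is a derivation. -/
theorem _root_.lie_lie_lie_lie (h3 : (3 : k) = 0) (x y z : L) :
    ⁅x, ⁅x, ⁅x, ⁅y, z⁆⁆⁆⁆ = ⁅⁅x, ⁅x, ⁅x, y⁆⁆⁆, z⁆ + ⁅y, ⁅x, ⁅x, ⁅x, z⁆⁆⁆⁆ := by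
  have h0 : ∀ m : L, (3 : k) • m = 0 := fun m => by rw [h3, zero_smul]
  rw [leibniz_lie x y z, lie_add, leibniz_lie x ⁅x, y⁆ z, leibniz_lie x y ⁅x, z⁆]
  simp only [lie_add]
  rw [leibniz_lie x ⁅x, ⁅x, y⁆⁆ z, leibniz_lie x ⁅x, y⁆ ⁅x, z⁆, leibniz_lie x y ⁅x, ⁅x, z⁆⁆]
  linear_combination (norm := module) h0 ⁅⁅x, ⁅x, y⁆⁆, ⁅x, z⁆⁆ + h0 ⁅⁅x, y⁆, ⁅x, ⁅x, z⁆⁆⁆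

/-- In characteristic three, extensions by a module on which `e` acts injectively split: the kernel
of the derivation `(ad e)³` is a complement. -/
theorem hasSlLift_of_injective (H : SlTripleMod I e h f) [FiniteDimensional k I] (h3 : (3 : k) = 0)
    (hinj : Function.Injective (LieModule.toEnd k L I e)) : HasSlLift I e h f := by
  obtain ⟨a, ha, b, hb, g, hg, h1, hf, h4⟩ := H.exists_defect
  have hm : ∀ x : L, ∀ m ∈ I, ⁅x, m⁆ ∈ I := fun x m hm => lie_mem_right k L I x m hm
  have hsurj : Function.Surjective (LieModule.toEnd k L I e) := LinearMap.surjective_of_injective hinj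
  have hs : ∀ y ∈ I, ∃ x ∈ I, ⁅e, x⁆ = y := by
    intro y hy
    obtain ⟨x, hx⟩ := hsurj ⟨y, hy⟩
    exact ⟨x, x.2, congrArg Subtype.val hx⟩
  have hi : ∀ x ∈ I, ⁅e, x⁆ = 0 → x = 0 := by
    intro x hx h0
    have : (⟨x, hx⟩ : I) = 0 := hinj (by rw [map_zero]; exact Subtype.ext h0)
    exact congrArg Subtype.val this
  have hi3 : ∀ x ∈ I, ⁅e, ⁅e, ⁅e, x⁆⁆⁆ = 0 → x = 0 := fun x hx h0 =>
    hi x hx (hi _ (hm _ _ hx) (hi _ (hm _ _ (hm _ _ hx)) h0))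
  -- As (ad e)³ is bijective on I, any y that it maps into I can be moved into its kernel by an
  -- element of I.
  have hlift : ∀ y : L, ⁅e, ⁅e, ⁅e, y⁆⁆⁆ ∈ I → ∃ x ∈ I, ⁅e, ⁅e, ⁅e, y - x⁆⁆⁆ = 0 := by
    intro y hy
    obtain ⟨x₁, hx₁, e1⟩ := hs _ hy
    obtain ⟨x₂, hx₂, e2⟩ := hs _ hx₁
    obtain ⟨x, hx, e3⟩ := hs _ hx₂
    refine ⟨x, hx, ?_⟩
    rw [lie_sub, lie_sub, lie_sub, e3, e2, e1, sub_self]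
  have hee : ⁅e, ⁅e, h⁆⁆ = -⁅e, a⁆ := by
    rw [← lie_skew e h, h1, lie_neg, lie_add, lie_smul, lie_self, smul_zero, zero_add]
  have Dh : ⁅e, ⁅e, ⁅e, h⁆⁆⁆ ∈ I := by
    rw [hee]
    exact hm _ _ (I.neg_mem (hm _ _ ha))
  have Df : ⁅e, ⁅e, ⁅e, f⁆⁆⁆ ∈ I := by
    rw [h4, lie_add, lie_add, hee]
    exact I.add_mem (I.neg_mem (hm _ _ ha)) (hm _ _ (hm _ _ hg))
  obtain ⟨x, hx, hx0⟩ := hlift h Dh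
  obtain ⟨y, hy, hy0⟩ := hlift f Df
  have hlx : ∀ z, ⁅x, z⁆ ∈ I := fun z => lie_mem_left k L I x z hx
  have hly : ∀ z, ⁅z, y⁆ ∈ I := fun z => hm z y hy
  refine ⟨e, h - x, f - y, by simp, by simpa using hx, by simpa using hy, ?_, ?_, ?_⟩
  -- The kernel of a derivation is a subalgebra, so each remaining defect lies both in I and in this
  -- kernel, which meet in 0.
  · refine sub_eq_zero.1 (hi3 _ ?_ ?_)
    · rw [sub_lie, h1, show (2 : k) • e + a - ⁅x, e⁆ - (2 : k) • e = a - ⁅x, e⁆ by abel]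
      exact I.sub_mem ha (hlx _)
    · rw [lie_sub, lie_sub, lie_sub, lie_lie_lie_lie h3, hx0]
      simp
  · refine add_eq_zero_iff_eq_neg.1 (hi3 _ ?_ ?_)
    · rw [sub_lie, lie_sub, hf, show -((2 : k) • f) + b - ⁅h, y⁆ - ⁅x, f - y⁆ + (2 : k) • (f - y) =
        b - ⁅h, y⁆ - ⁅x, f - y⁆ - (2 : k) • y by module]
      exact I.sub_mem (I.sub_mem (I.sub_mem hb (hly _)) (hlx _)) (I.smul_mem _ hy)
    · rw [lie_add, lie_add, lie_add, lie_lie_lie_lie h3, hx0, hy0, lie_smul, lie_smul, lie_smul, hy0]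
      simp
  · refine sub_eq_zero.1 (hi3 _ ?_ ?_)
    · rw [lie_sub, h4, show h + g - ⁅e, y⁆ - (h - x) = g - ⁅e, y⁆ + x by abel]
      exact I.add_mem (I.sub_mem hg (hly _)) hx
    · rw [lie_sub, lie_sub, lie_sub, lie_lie_lie_lie h3, hx0, hy0]
      simp

theorem _root_.HasSlLift.swap (H : HasSlLift I f (-h) e) : HasSlLift I e h f := by
  obtain ⟨f', h', e', q1, q2, q3, q4, q5, q6⟩ := H
  refine ⟨e', -h', f', q3, ?_, q1, ?_, ?_, ?_⟩
  · rw [show -h' - h = -(h' - -h) by abel]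
    exact I.neg_mem q2
  · rw [neg_lie, q5, neg_neg]
  · rw [neg_lie, q4]
  · rw [← lie_skew, q6]

/-- Extensions by an irreducible three-dimensional module split. -/
theorem hasSlLift_of_irreducible (H : SlTripleMod I e h f) (hab : ∀ x ∈ I, ∀ y ∈ I, ⁅x, y⁆ = 0)
    {p : ℕ} [CharP k p] (hp : 3 ≤ p) (hI : finrank k I = 3)
    (hirr : ∀ W : Submodule k L, (∀ m ∈ W, m ∈ I) → (∀ m ∈ W, ⁅e, m⁆ ∈ W) → (∀ m ∈ W, ⁅h, m⁆ ∈ W) →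
      (∀ m ∈ W, ⁅f, m⁆ ∈ W) → W = ⊥ ∨ ∀ m ∈ I, m ∈ W) : HasSlLift I e h f := by
  have hfin : FiniteDimensional k I := FiniteDimensional.of_finrank_pos (by omega)
  rcases (H.slAction hab).casimir_or_injective hp hI (by
    intro W he hh hf
    have aux : ∀ x : L, (∀ m ∈ W, LieModule.toEnd k L I x m ∈ W) →
        ∀ m ∈ W.map I.toSubmodule.subtype, ⁅x, m⁆ ∈ W.map I.toSubmodule.subtype := by
      rintro x hx _ ⟨m, hm, rfl⟩
      exact ⟨_, hx m hm, rfl⟩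
    rcases hirr (W.map I.toSubmodule.subtype) (by rintro _ ⟨m, -, rfl⟩; exact m.2)
      (aux e he) (aux h hh) (aux f hf) with h1 | h1
    · left
      rw [eq_bot_iff]
      intro m hm
      have hm' : (m : L) ∈ W.map I.toSubmodule.subtype := ⟨m, hm, rfl⟩
      rw [h1, Submodule.mem_bot] at hm'
      exact Subtype.ext hm'
    · right
      rw [Submodule.eq_top_iff']
      intro m
      obtain ⟨n, hn, hnm⟩ := h1 m m.2
      rwa [← Subtype.ext (a1 := n) (a2 := m) hnm]) with ⟨rfl, h1 | h1⟩ | ⟨c, hc, h1⟩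
  · exact H.hasSlLift_of_injective (by exact_mod_cast CharP.cast_eq_zero k 3) h1
  · exact (H.swap.hasSlLift_of_injective (by exact_mod_cast CharP.cast_eq_zero k 3) h1).swap
  · exact H.hasSlLift_of_casimir hab hc fun m hm => congrArg Subtype.val (h1 ⟨m, hm⟩)

end SlTripleMod

end Lifting

/-! ### Extensions of sl(2) by the natural module in characteristic three. -/

section TwistedTable

variable {k : Type u} {L : Type v} [Field k] [LieRing L] [LieAlgebra k L]

/-- The Frobenius map of a finite field is bijective. These cube roots solve the normalisation
equations produced by shears. -/
theorem exists_pow_three_eq {k : Type u} [Field k] [Finite k] (h3 : (3 : k) = 0) (x : k) :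
    ∃ t : k, t ^ 3 = x := by
  have : CharP k 3 := (CharP.charP_iff_prime_eq_zero Nat.prime_three).2 (by exact_mod_cast h3)
  have : Fact (Nat.Prime 3) := ⟨Nat.prime_three⟩
  exact Finite.surjective_of_injective (frobenius_inj k 3) x

/-- A multiplication table of an extension of `sl(2)` by its natural module in characteristic
three, depending on a cocycle with parameters `a` and `b`. -/
structure TwistedTable (a b : k) (e h f v₀ v₁ : L) : Prop where
  h_e : ⁅h, e⁆ = -e + a • v₁
  h_f : ⁅h, f⁆ = f + b • v₀
  e_f : ⁅e, f⁆ = h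
  h_v₀ : ⁅h, v₀⁆ = v₀
  h_v₁ : ⁅h, v₁⁆ = -v₁
  e_v₀ : ⁅e, v₀⁆ = 0
  e_v₁ : ⁅e, v₁⁆ = v₀
  f_v₀ : ⁅f, v₀⁆ = v₁
  f_v₁ : ⁅f, v₁⁆ = 0
  v₀_v₁ : ⁅v₀, v₁⁆ = 0

namespace TwistedTable

variable {a b : k} {e h f v₀ v₁ : L}

/-- Exchanging e and f exchanges the two parameters up to sign, so it is enough to make one of them
vanish. -/
theorem swap (T : TwistedTable a b e h f v₀ v₁) : TwistedTable (-b) (-a) f (-h) e v₁ v₀ where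
  h_e := by rw [neg_lie, T.h_f]; module
  h_f := by rw [neg_lie, T.h_e]; module
  e_f := by rw [← lie_skew, T.e_f]
  h_v₀ := by rw [neg_lie, T.h_v₁, neg_neg]
  h_v₁ := by rw [neg_lie, T.h_v₀]
  e_v₀ := T.f_v₁
  e_v₁ := T.f_v₀
  f_v₀ := T.e_v₁
  f_v₁ := T.e_v₀
  v₀_v₁ := by rw [← lie_skew, T.v₀_v₁, neg_zero]

/-- Up to multiples of v₀ this is the exponential of t ad f truncated after the quadratic term. The
cubic term would need 1/6, which does not exist here; its absence is what changes `a` by t³ b. -/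
theorem shear (T : TwistedTable a b e h f v₀ v₁) (h3 : (3 : k) = 0) (t : k) :
    TwistedTable (a - t ^ 3 * b) b (e - t • h - t ^ 2 • f) (h - t • f - (t * b) • v₀) f
      (v₀ + t • v₁) v₁ := by
  have h0 : ∀ m : L, (3 : k) • m = 0 := fun m => by rw [h3, zero_smul]
  have f_h : ⁅f, h⁆ = -f - b • v₀ := by rw [← lie_skew, T.h_f]; module
  have f_e : ⁅f, e⁆ = -h := by rw [← lie_skew, T.e_f]
  have v₀_h : ⁅v₀, h⁆ = -v₀ := by rw [← lie_skew, T.h_v₀]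
  have v₀_e : ⁅v₀, e⁆ = 0 := by rw [← lie_skew, T.e_v₀, neg_zero]
  have v₀_f : ⁅v₀, f⁆ = -v₁ := by rw [← lie_skew, T.f_v₀]
  constructor <;> simp only [lie_add, add_lie, lie_sub, sub_lie, lie_smul, smul_lie, lie_self,
    T.h_e, T.h_f, T.e_f, T.h_v₀, T.h_v₁, T.e_v₀, T.e_v₁, T.f_v₀, T.f_v₁, T.v₀_v₁, f_h, f_e,
    v₀_h, v₀_e, v₀_f]
  · linear_combination (norm := module) -t ^ 2 • h0 f - (t ^ 2 * b) • h0 v₀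
  · module
  · module
  · linear_combination (norm := module) -t • h0 v₁
  · module
  · module
  · module
  · module
  · module

theorem leviTable (T : TwistedTable a 0 e h f v₀ v₁) :
    LeviTable e h f (a • v₀) (a • v₁) 0 0 := by
  constructor <;> simp only [lie_smul, smul_lie, T.h_e, T.h_f, T.e_f, T.h_v₀, T.h_v₁, T.e_v₀,
    T.e_v₁, T.f_v₀, T.f_v₁, T.v₀_v₁, smul_zero, zero_smul, add_zero, smul_neg]

/-- A nonzero cocycle can be normalised. -/
theorem exists_leviTable [Finite k] (T : TwistedTable a b e h f v₀ v₁) (h3 : (3 : k) = 0)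
    (hne : a ≠ 0 ∨ b ≠ 0) : ∃ e' h' f' v₀' v₁' : L, LeviTable e' h' f' v₀' v₁' 0 0 ∧
      v₀' ∈ Submodule.span k {v₀, v₁} ∧ v₁' ∈ Submodule.span k {v₀, v₁} ∧
      (∀ W : Submodule k L, v₀' ∈ W → v₁' ∈ W → v₀ ∈ W ∧ v₁ ∈ W) ∧
      (∀ W : Submodule k L, e' ∈ W → h' ∈ W → f' ∈ W → v₀' ∈ W → v₁' ∈ W →
        e ∈ W ∧ h ∈ W ∧ f ∈ W) := by
  have hm₀ : v₀ ∈ Submodule.span k {v₀, v₁} := Submodule.subset_span (by simp)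
  have hm₁ : v₁ ∈ Submodule.span k {v₀, v₁} := Submodule.subset_span (by simp)
  have hsm : ∀ (W : Submodule k L) {c : k} {x : L}, c ≠ 0 → c • x ∈ W → x ∈ W :=
    fun W c x hc hx => (W.smul_mem_iff hc).1 hx
  by_cases hb : b = 0
  · subst hb
    have ha : a ≠ 0 := by simpa using hne
    exact ⟨e, h, f, _, _, T.leviTable, Submodule.smul_mem _ _ hm₀, Submodule.smul_mem _ _ hm₁,
      fun W h1 h2 => ⟨hsm W ha h1, hsm W ha h2⟩, fun W h1 h2 h3 _ _ => ⟨h1, h2, h3⟩⟩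
  -- This t makes the first parameter vanish; `swap` then moves the remaining one, -b, into the
  -- first place.
  · obtain ⟨t, ht⟩ := exists_pow_three_eq h3 (a / b)
    have T' := T.shear h3 t
    rw [ht, div_mul_cancel₀ _ hb, sub_self] at T'
    have T'' := T'.swap
    rw [neg_zero] at T''
    have hb' : -b ≠ 0 := neg_ne_zero.2 hb
    have key : ∀ W : Submodule k L, (-b) • v₁ ∈ W → (-b) • (v₀ + t • v₁) ∈ W →
        v₀ ∈ W ∧ v₁ ∈ W := by
      intro W h1 h2
      have q1 := hsm W hb' h1
      have q2 := W.sub_mem (hsm W hb' h2) (W.smul_mem t q1)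
      rw [add_sub_cancel_right] at q2
      exact ⟨q2, q1⟩
    refine ⟨_, _, _, _, _, T''.leviTable, Submodule.smul_mem _ _ hm₁, Submodule.smul_mem _ _
      (add_mem hm₀ (Submodule.smul_mem _ _ hm₁)), key, fun W h1 h2 h4 h5 h6 => ?_⟩
    obtain ⟨q1, -⟩ := key W h5 h6
    have q3 : h ∈ W := by
      have := W.add_mem (W.add_mem (W.neg_mem h2) (W.smul_mem t h1)) (W.smul_mem (t * b) q1)
      convert this using 1
      module
    have q4 : e ∈ W := by
      have := W.add_mem (W.add_mem h4 (W.smul_mem t q3)) (W.smul_mem (t ^ 2) h1)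
      convert this using 1
      module
    exact ⟨q4, q3, h1⟩

end TwistedTable

namespace SlTripleMod

variable {I : LieIdeal k L} {e h f : L}

/-- Extensions by a two-dimensional abelian ideal either split, or the characteristic is three and
they contain the algebra `L₁`. -/
theorem hasSlLift_or_leviTable [Finite k] (H : SlTripleMod I e h f) (h2 : (2 : k) ≠ 0)
    (hab : ∀ x ∈ I, ∀ y ∈ I, ⁅x, y⁆ = 0) (hI : finrank k I = 2) :
    HasSlLift I e h f ∨ ((3 : k) = 0 ∧ ∃ e' h' f' v₀ v₁ : L, LeviTable e' h' f' v₀ v₁ 0 0 ∧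
      v₀ ∈ I ∧ v₁ ∈ I ∧ (∀ m ∈ I, m ∈ Submodule.span k {v₀, v₁}) ∧
      e ∈ Submodule.span k {e', h', f', v₀, v₁} ∧ h ∈ Submodule.span k {e', h', f', v₀, v₁} ∧
      f ∈ Submodule.span k {e', h', f', v₀, v₁}) := by
  by_cases he : LieModule.toEnd k L I e = 0
  · obtain ⟨hh, hf⟩ := (H.slAction hab).eq_zero_of_e_eq_zero h2 he
    have aux : ∀ x : L, LieModule.toEnd k L I x = 0 → ∀ m ∈ I, ⁅x, m⁆ = 0 := fun x hx m hm =>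
      congrArg Subtype.val (LinearMap.congr_fun hx ⟨m, hm⟩)
    exact Or.inl (H.hasSlLift_of_trivial h2 hab (aux e he) (aux h hh) (aux f hf))
  obtain ⟨⟨v₀, hv₀⟩, ⟨v₁, hv₁⟩, hne, hspan, w1, w2, w3, w4, w5, w6⟩ :=
    (H.slAction hab).exists_natural_basis h2 hI he
  replace hne : v₀ ≠ 0 := fun h0 => hne (Subtype.ext h0)
  replace w1 : ⁅h, v₀⁆ = v₀ := congrArg Subtype.val w1
  replace w2 : ⁅h, v₁⁆ = -v₁ := congrArg Subtype.val w2
  replace w3 : ⁅e, v₀⁆ = 0 := congrArg Subtype.val w3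
  replace w4 : ⁅e, v₁⁆ = v₀ := congrArg Subtype.val w4
  replace w5 : ⁅f, v₀⁆ = v₁ := congrArg Subtype.val w5
  replace w6 : ⁅f, v₁⁆ = 0 := congrArg Subtype.val w6
  replace hspan : ∀ m ∈ I, ∃ a b : k, m = a • v₀ + b • v₁ := by
    intro m hm
    obtain ⟨a, b, hab⟩ := hspan ⟨m, hm⟩
    exact ⟨a, b, congrArg Subtype.val hab⟩
  by_cases h3 : (3 : k) = 0
  swap
  · left
    -- On the natural module the Casimir element acts by 3.
    refine H.hasSlLift_of_casimir hab h3 fun m hm => ?_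
    obtain ⟨a, b, rfl⟩ := hspan m hm
    simp only [lie_add, lie_smul, lie_neg, w1, w2, w3, w4, w5, w6, lie_zero]
    module
  have h0 : ∀ m : L, (3 : k) • m = 0 := fun m => by rw [h3, zero_smul]
  obtain ⟨a, ha, b, hb, g, hg, d1, d2, d3⟩ := H.exists_defect
  have hgm : ∀ m ∈ I, ⁅h + g, m⁆ = ⁅h, m⁆ := fun m hm => by
    rw [add_lie, hab g hg m hm, add_zero]
  obtain ⟨a₀, a₁, ha'⟩ := hspan (a + ⁅g, e⁆) (I.add_mem ha (lie_mem_left k L I g e hg))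
  obtain ⟨b₀, b₁, hb'⟩ := hspan (b + ⁅g, f⁆) (I.add_mem hb (lie_mem_left k L I g f hg))
  have k1 : ⁅h + g, e⁆ = -e + (a₀ • v₀ + a₁ • v₁) := by
    rw [← ha', add_lie, d1]
    linear_combination (norm := module) h0 e
  have k2 : ⁅h + g, f⁆ = f + (b₀ • v₀ + b₁ • v₁) := by
    rw [← hb', add_lie, d2]
    linear_combination (norm := module) -h0 f
  -- With h replaced by h + g = [e, f], the Jacobi identity on h, e, f leaves only the v₁-component
  -- at e and the v₀-component at f.
  have hrel : b₁ • v₀ = a₀ • v₁ := by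
    have := leibniz_lie (h + g) e f
    rw [d3, lie_self, k1, k2, add_lie, lie_add, neg_lie,
      ← lie_skew (a₀ • v₀ + a₁ • v₁) f] at this
    simp only [lie_add, lie_smul, w3, w4, w5, w6] at this
    linear_combination (norm := module) -this
  have hb₁ : b₁ = 0 := by
    have := congrArg (⁅h, ·⁆) hrel
    simp only [lie_smul, w1, w2] at this
    have h4 : (2 * b₁) • v₀ = 0 := by linear_combination (norm := module) this + hrel
    simpa [h2, hne] using h4
  have ha₀ : a₀ = 0 := by
    have := congrArg (⁅e, ·⁆) hrel
    simp only [lie_smul, w3, w4, smul_zero] at this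
    simpa [hne] using this.symm
  rw [ha₀, zero_smul, zero_add] at k1
  rw [hb₁, zero_smul, add_zero] at k2
  by_cases hz : a₁ = 0 ∧ b₀ = 0
  · left
    refine ⟨e, h + g, f, by simp, by simpa using hg, by simp, ?_, ?_, d3⟩
    · rw [k1, hz.1]
      linear_combination (norm := module) -h0 e
    · rw [k2, hz.2]
      linear_combination (norm := module) h0 f
  · right
    refine ⟨h3, ?_⟩
    have T : TwistedTable a₁ b₀ e (h + g) f v₀ v₁ :=
      ⟨k1, k2, d3, by rw [hgm _ hv₀, w1], by rw [hgm _ hv₁, w2], w3, w4, w5, w6, hab _ hv₀ _ hv₁⟩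
    obtain ⟨e', h', f', v₀', v₁', T', q1, q2, q3, q4⟩ := T.exists_leviTable h3 (by tauto)
    have hle : Submodule.span k {v₀, v₁} ≤ I.toSubmodule := by
      rw [Submodule.span_le]
      rintro x (rfl | rfl)
      · exact hv₀
      · exact hv₁
    have hs : ∀ m ∈ I, ∀ W : Submodule k L, v₀' ∈ W → v₁' ∈ W → m ∈ W := by
      intro m hm W h1 h2
      obtain ⟨a, b, rfl⟩ := hspan m hm
      exact W.add_mem (W.smul_mem _ (q3 W h1 h2).1) (W.smul_mem _ (q3 W h1 h2).2)
    refine ⟨e', h', f', v₀', v₁', T', hle q1, hle q2, fun m hm => hs m hm _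
      (Submodule.subset_span (by simp)) (Submodule.subset_span (by simp)), ?_⟩
    have s0 : v₀' ∈ Submodule.span k {e', h', f', v₀', v₁'} := Submodule.subset_span (by simp)
    have s1 : v₁' ∈ Submodule.span k {e', h', f', v₀', v₁'} := Submodule.subset_span (by simp)
    obtain ⟨r1, r2, r3⟩ := q4 (Submodule.span k {e', h', f', v₀', v₁'})
      (Submodule.subset_span (by simp)) (Submodule.subset_span (by simp))
      (Submodule.subset_span (by simp)) s0 s1
    refine ⟨r1, ?_, r3⟩
    have := Submodule.sub_mem _ r2 (hs g hg _ s0 s1)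
    rwa [add_sub_cancel_right] at this

end SlTripleMod

end TwistedTable

/-! ### Reducing extensions of and by L₁ to the standard tables. -/

section TableRecognition

variable {k : Type u} {L : Type v} [Field k] [LieRing L] [LieAlgebra k L]

/-- Generation is phrased through all subspaces containing the family, so that a change of
generators becomes a check of memberships. -/
theorem exists_basis_of_generating (hL : finrank k L = 6) (x : Fin 6 → L)
    (hx : ∀ W : Submodule k L, (∀ i, x i ∈ W) → ∀ y, y ∈ W) : ∃ b : Basis (Fin 6) k L, ⇑b = x := by
  have : FiniteDimensional k L := FiniteDimensional.of_finrank_pos (by omega)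
  have hspan : ⊤ ≤ Submodule.span k (Set.range x) := fun y _ =>
    hx _ (fun i => Submodule.subset_span (Set.mem_range_self i)) y
  exact ⟨basisOfTopLeSpanOfCardEqFinrank x hspan (by simp [hL]),
    coe_basisOfTopLeSpanOfCardEqFinrank _ _ _⟩

namespace LeviTable

variable {e h f v₀ v₁ x y : L}

theorem e_h (T : LeviTable e h f v₀ v₁ x y) : ⁅e, h⁆ = e - v₁ := by
  rw [← lie_skew, T.h_e]; abel

theorem f_h (T : LeviTable e h f v₀ v₁ x y) : ⁅f, h⁆ = -f := by rw [← lie_skew, T.h_f]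

theorem f_e (T : LeviTable e h f v₀ v₁ x y) : ⁅f, e⁆ = -h := by rw [← lie_skew, T.e_f]

theorem v₀_h (T : LeviTable e h f v₀ v₁ x y) : ⁅v₀, h⁆ = -v₀ := by rw [← lie_skew, T.h_v₀]

theorem v₁_h (T : LeviTable e h f v₀ v₁ x y) : ⁅v₁, h⁆ = v₁ := by
  rw [← lie_skew, T.h_v₁, neg_neg]

theorem v₀_e (T : LeviTable e h f v₀ v₁ x y) : ⁅v₀, e⁆ = -x := by rw [← lie_skew, T.e_v₀]

theorem v₁_e (T : LeviTable e h f v₀ v₁ x y) : ⁅v₁, e⁆ = -v₀ := by rw [← lie_skew, T.e_v₁]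

theorem v₀_f (T : LeviTable e h f v₀ v₁ x y) : ⁅v₀, f⁆ = -v₁ := by rw [← lie_skew, T.f_v₀]

theorem v₁_f (T : LeviTable e h f v₀ v₁ x y) : ⁅v₁, f⁆ = 0 := by
  rw [← lie_skew, T.f_v₁, neg_zero]

theorem v₁_v₀ (T : LeviTable e h f v₀ v₁ x y) : ⁅v₁, v₀⁆ = -y := by rw [← lie_skew, T.v₀_v₁]

/-- The table remains valid under the substitution of `exp (-t ad f)` for the basis, up to
correction by the cocycle. -/
theorem shear (T : LeviTable e h f v₀ v₁ 0 0) (h3 : (3 : k) = 0) (t : k) :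
    LeviTable (e - t • h - t ^ 2 • f) (h - t • f) f (v₀ + t • v₁) v₁ 0 0 := by
  have T' : TwistedTable (1 : k) 0 e h f v₀ v₁ :=
    ⟨by rw [T.h_e, one_smul], by rw [T.h_f, zero_smul, add_zero], T.e_f, T.h_v₀, T.h_v₁, T.e_v₀,
      T.e_v₁, T.f_v₀, T.f_v₁, T.v₀_v₁⟩
  have := T'.shear h3 t
  simp only [mul_zero, sub_zero, zero_smul] at this
  simpa using this.leviTable

end LeviTable

theorem isDerivationExtensionOfL₁_of_generating (hL : finrank k L = 6) {d e h f v₀ v₁ : L}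
    (T : LeviTable e h f v₀ v₁ 0 0) {α β : k} (de : ⁅d, e⁆ = α • v₁) (df : ⁅d, f⁆ = β • v₀)
    (dh : ⁅d, h⁆ = 0) (dv₀ : ⁅d, v₀⁆ = 0) (dv₁ : ⁅d, v₁⁆ = 0)
    (hgen : ∀ W : Submodule k L, d ∈ W → e ∈ W → h ∈ W → f ∈ W → v₀ ∈ W → v₁ ∈ W → ∀ y, y ∈ W) :
    IsDerivationExtensionOfL₁ k L α β := by
  obtain ⟨b, hb⟩ := exists_basis_of_generating hL ![d, e, h, f, v₀, v₁]
    (fun W hW => hgen W (hW 0) (hW 1) (hW 2) (hW 3) (hW 4) (hW 5))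
  let N : Submodule k L := Submodule.span k {e, h, f, v₀, v₁}
  have ne : e ∈ N := Submodule.subset_span (by simp)
  have nh : h ∈ N := Submodule.subset_span (by simp)
  have nf : f ∈ N := Submodule.subset_span (by simp)
  have nv₀ : v₀ ∈ N := Submodule.subset_span (by simp)
  have nv₁ : v₁ ∈ N := Submodule.subset_span (by simp)
  have hN : ∀ x : L, (⁅x, e⁆ ∈ N ∧ ⁅x, h⁆ ∈ N ∧ ⁅x, f⁆ ∈ N ∧ ⁅x, v₀⁆ ∈ N ∧ ⁅x, v₁⁆ ∈ N) →
      ∀ m ∈ N, ⁅x, m⁆ ∈ N := by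
    rintro x ⟨h1, h2, h3, h4, h5⟩ m hm
    refine (Submodule.span_le (p := N.comap (LieAlgebra.ad k L x))).2 ?_ hm
    rintro y (rfl | rfl | rfl | rfl | rfl) <;> assumption
  have hmem : ∀ x m : L, m ∈ N → ⁅x, m⁆ ∈ N := by
    intro x m hm
    -- For fixed m the elements x with [x, m] in N form a subspace, so the ideal property need only
    -- be tested on generators.
    let P : Submodule k L := N.comap ((LieModule.toEnd k L L : L →ₗ[k] Module.End k L).flip m)
    refine hgen P ?_ ?_ ?_ ?_ ?_ ?_ x
    · refine hN d ?_ m hm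
      rw [de, dh, df, dv₀, dv₁]
      exact ⟨N.smul_mem _ nv₁, N.zero_mem, N.smul_mem _ nv₀, N.zero_mem, N.zero_mem⟩
    · refine hN e ?_ m hm
      rw [lie_self, T.e_h, T.e_f, T.e_v₀, T.e_v₁]
      exact ⟨N.zero_mem, N.sub_mem ne nv₁, nh, N.zero_mem, nv₀⟩
    · refine hN h ?_ m hm
      rw [lie_self, T.h_e, T.h_f, T.h_v₀, T.h_v₁]
      exact ⟨N.add_mem (N.neg_mem ne) nv₁, N.zero_mem, nf, nv₀, N.neg_mem nv₁⟩
    · refine hN f ?_ m hm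
      rw [lie_self, T.f_h, T.f_e, T.f_v₀, T.f_v₁]
      exact ⟨N.neg_mem nh, N.neg_mem nf, N.zero_mem, nv₁, N.zero_mem⟩
    · refine hN v₀ ?_ m hm
      rw [lie_self, T.v₀_h, T.v₀_e, T.v₀_f, T.v₀_v₁, neg_zero]
      exact ⟨N.zero_mem, N.neg_mem nv₀, N.neg_mem nv₁, N.zero_mem, N.zero_mem⟩
    · refine hN v₁ ?_ m hm
      rw [lie_self, T.v₁_h, T.v₁_e, T.v₁_f, T.v₁_v₀, neg_zero]
      exact ⟨N.neg_mem nv₀, nv₁, N.zero_mem, N.zero_mem, N.zero_mem⟩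
  refine ⟨d, e, h, f, v₀, v₁, b, { N with lie_mem := fun {x m} hm => hmem x m hm }, hb, rfl, ?_, T,
    de, df, dh, dv₀, dv₁⟩
  change finrank k N = 5
  have hli : LinearIndependent k ![e, h, f, v₀, v₁] := by
    have := b.linearIndependent.comp Fin.succ (Fin.succ_injective 5)
    rw [hb] at this
    convert this using 1
    ext i
    fin_cases i <;> rfl
  have hr : Set.range ![e, h, f, v₀, v₁] = {e, h, f, v₀, v₁} := by
    ext y
    simp only [Matrix.range_cons, Matrix.range_empty, Set.union_empty, Set.mem_union,
      Set.mem_singleton_iff, Set.mem_insert_iff]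
  have := finrank_span_eq_card hli
  rwa [hr] at this

/-- Extensions of `L₁` by derivations into the ideal spanned by `v₀, v₁` have one of the standard
tables. -/
theorem exists_tableType_of_derivation [Finite k] (h2 : (2 : k) ≠ 0) (h3 : (3 : k) = 0)
    (hL : finrank k L = 6)
    {d e h f v₀ v₁ : L} (T : LeviTable e h f v₀ v₁ 0 0)
    (de : ⁅d, e⁆ ∈ Submodule.span k {v₀, v₁}) (dh : ⁅d, h⁆ ∈ Submodule.span k {v₀, v₁})
    (df : ⁅d, f⁆ ∈ Submodule.span k {v₀, v₁}) (dv₀ : ⁅d, v₀⁆ ∈ Submodule.span k {v₀, v₁})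
    (hgen : ∀ W : Submodule k L, d ∈ W → e ∈ W → h ∈ W → f ∈ W → v₀ ∈ W → v₁ ∈ W → ∀ y, y ∈ W) :
    ∃ t : TableType, HasTableType k L t := by
  have h0 : ∀ m : L, (3 : k) • m = 0 := fun m => by rw [h3, zero_smul]
  -- Since h acts invertibly on the span of v₀ and v₁, an inner derivation from that span cancels
  -- [d, h].
  wlog dh0 : ⁅d, h⁆ = 0 generalizing d
  · obtain ⟨x, y, hxy⟩ := Submodule.mem_span_pair.1 dh
    have m0 : v₀ ∈ Submodule.span k {v₀, v₁} := Submodule.subset_span (by simp)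
    have m1 : v₁ ∈ Submodule.span k {v₀, v₁} := Submodule.subset_span (by simp)
    refine this (d := d + x • v₀ - y • v₁) ?_ ?_ ?_ ?_ ?_ ?_
    · rw [sub_lie, add_lie, smul_lie, smul_lie, T.v₀_e, T.v₁_e, neg_zero, smul_zero, add_zero]
      exact sub_mem de (Submodule.smul_mem _ _ (neg_mem m0))
    · rw [sub_lie, add_lie, smul_lie, smul_lie, T.v₀_h, T.v₁_h]
      exact sub_mem (add_mem dh (Submodule.smul_mem _ _ (neg_mem m0))) (Submodule.smul_mem _ _ m1)
    · rw [sub_lie, add_lie, smul_lie, smul_lie, T.v₀_f, T.v₁_f, smul_zero, sub_zero]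
      exact add_mem df (Submodule.smul_mem _ _ (neg_mem m1))
    · rw [sub_lie, add_lie, smul_lie, smul_lie, T.v₁_v₀, lie_self, neg_zero, smul_zero, smul_zero,
        sub_zero, add_zero]
      exact dv₀
    · intro W hd he hh hf h0 h1
      refine hgen W ?_ he hh hf h0 h1
      have := W.add_mem (W.sub_mem hd (W.smul_mem x h0)) (W.smul_mem y h1)
      convert this using 1
      abel
    · rw [sub_lie, add_lie, smul_lie, smul_lie, T.v₀_h, T.v₁_h, ← hxy]
      module
  obtain ⟨b, hb⟩ := exists_basis_of_generating hL ![d, e, h, f, v₀, v₁]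
    (fun W hW => hgen W (hW 0) (hW 1) (hW 2) (hW 3) (hW 4) (hW 5))
  have hli : ∀ x y : k, x • v₀ + y • v₁ = 0 → x = 0 ∧ y = 0 := by
    intro x y hxy
    have := Fintype.linearIndependent_iff.1 b.linearIndependent ![0, 0, 0, 0, x, y]
      (by rw [hb]; simpa [Fin.sum_univ_succ] using hxy)
    exact ⟨this 4, this 5⟩
  obtain ⟨x, y, hxy⟩ := Submodule.mem_span_pair.1 dv₀
  obtain ⟨α₀, α, hα⟩ := Submodule.mem_span_pair.1 de
  obtain ⟨β, β₁, hβ⟩ := Submodule.mem_span_pair.1 df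
  have hd0 : ⁅h, d⁆ = 0 := by rw [← lie_skew, dh0, neg_zero]
  -- Now ad d commutes with ad h, and v₀, v₁ have the distinct weights 1 and -1.
  have hy : y = 0 := by
    have := leibniz_lie h d v₀
    rw [hd0, zero_lie, T.h_v₀, ← hxy, lie_add, lie_smul, lie_smul, T.h_v₀, T.h_v₁] at this
    have := (hli 0 (2 * y) (by linear_combination (norm := module) -this)).2
    simpa [h2] using this
  rw [hy, zero_smul, add_zero] at hxy
  have dv₁ : ⁅d, v₁⁆ = x • v₁ := by
    have := leibniz_lie d f v₀
    rw [T.f_v₀, ← hβ, ← hxy, add_lie, smul_lie, smul_lie, lie_self, T.v₁_v₀, lie_smul,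
      T.f_v₀] at this
    rw [this]
    module
  have hαβ : α₀ = 0 ∧ β₁ = 0 := by
    have := leibniz_lie d e f
    rw [T.e_f, dh0, ← hα, ← hβ, add_lie, smul_lie, smul_lie, T.v₀_f, T.v₁_f, lie_add, lie_smul,
      lie_smul, T.e_v₀, T.e_v₁] at this
    have := hli β₁ (-α₀) (by linear_combination (norm := module) -this)
    exact ⟨neg_eq_zero.1 this.2, this.1⟩
  rw [hαβ.1, zero_smul, zero_add] at hα
  rw [hαβ.2, zero_smul, add_zero] at hβ
  -- So d acts on the plane by the scalar x. The term v₁ in [h, e] = -e + v₁ rules out x ≠ 0,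
  -- because [d, e] is a multiple of v₁ and has weight -1.
  have hx : x = 0 := by
    have := leibniz_lie h d e
    rw [hd0, zero_lie, ← hα, T.h_e, lie_add, lie_neg, ← hα, dv₁, lie_smul, T.h_v₁] at this
    exact (hli 0 x (by linear_combination (norm := module) -this)).2
  rw [hx, zero_smul] at hxy dv₁
  by_cases hβ0 : β = 0
  · rw [hβ0, zero_smul] at hβ
    by_cases hα0 : α = 0
    · rw [hα0, zero_smul] at hα
      obtain ⟨b', hb'⟩ := exists_basis_of_generating hL ![e, h, f, v₀, v₁, d]
        (fun W hW => hgen W (hW 5) (hW 0) (hW 1) (hW 2) (hW 3) (hW 4))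
      refine ⟨.central00, e, h, f, v₀, v₁, d, b', hb', by simpa using T, fun y => ?_⟩
      exact hgen (LinearMap.ker (LieAlgebra.ad k L d)) (lie_self d) hα.symm dh0 hβ.symm
        hxy.symm dv₁ y
    · refine ⟨.deriv1, isDerivationExtensionOfL₁_of_generating hL T (d := α⁻¹ • d) ?_ ?_ ?_ ?_ ?_ ?_⟩
      · rw [smul_lie, ← hα, inv_smul_smul₀ hα0, one_smul]
      · rw [smul_lie, ← hβ, smul_zero, zero_smul]
      · rw [smul_lie, dh0, smul_zero]
      · rw [smul_lie, ← hxy, smul_zero]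
      · rw [smul_lie, dv₁, smul_zero]
      · intro W hd
        exact hgen W ((W.smul_mem_iff (inv_ne_zero hα0)).1 hd)
  -- The shear by t adds t³ to the normalised coefficient α/β of [d, e]. The terms subtracted from
  -- β⁻¹ d restore the vanishing of its bracket with the new h.
  · obtain ⟨t, ht⟩ := exists_pow_three_eq h3 (-(β⁻¹ * α))
    refine ⟨.deriv2, isDerivationExtensionOfL₁_of_generating hL (T.shear h3 t)
      (d := β⁻¹ • d - t • (v₀ + t • v₁) - t ^ 2 • v₁) ?_ ?_ ?_ ?_ ?_ ?_⟩
    all_goals try simp only [lie_add, lie_sub, lie_smul, sub_lie, add_lie, smul_lie, ← hα, ← hβ,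
      dh0, ← hxy, dv₁, T.v₀_e, T.v₀_h, T.v₀_f, T.v₁_e, T.v₁_h, T.v₁_f, T.v₀_v₁, T.v₁_v₀, lie_self,
      smul_smul, inv_mul_cancel₀ hβ0]
    · have : β⁻¹ * α = -t ^ 3 := by rw [ht, neg_neg]
      rw [this]
      module
    · module
    · linear_combination (norm := module) -(t ^ 2) • h0 v₁
    · module
    · module
    · intro W hd he hh hf h0 h1
      have q0 := W.sub_mem h0 (W.smul_mem t h1)
      rw [add_sub_cancel_right] at q0
      have qh := W.add_mem hh (W.smul_mem t hf)
      rw [sub_add_cancel] at qh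
      have qe := W.add_mem (W.add_mem he (W.smul_mem (t ^ 2) hf)) (W.smul_mem t qh)
      have qd := W.add_mem (W.add_mem hd (W.smul_mem (t ^ 2) h1)) (W.smul_mem t h0)
      rw [sub_add_cancel, sub_add_cancel] at qd qe
      exact hgen W ((W.smul_mem_iff (inv_ne_zero hβ0)).1 qd) qe qh hf q0 h1

/-- A multiplication table of `L₁` modulo the ideal `J`. -/
structure LeviTableMod (J : LieIdeal k L) (e h f v₀ v₁ : L) : Prop where
  h_e : ∃ j ∈ J, ⁅h, e⁆ = -e + v₁ + j
  h_f : ∃ j ∈ J, ⁅h, f⁆ = f + j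
  e_f : ∃ j ∈ J, ⁅e, f⁆ = h + j
  h_v₀ : ∃ j ∈ J, ⁅h, v₀⁆ = v₀ + j
  h_v₁ : ∃ j ∈ J, ⁅h, v₁⁆ = -v₁ + j
  e_v₀ : ∃ j ∈ J, ⁅e, v₀⁆ = j
  e_v₁ : ∃ j ∈ J, ⁅e, v₁⁆ = v₀ + j
  f_v₀ : ∃ j ∈ J, ⁅f, v₀⁆ = v₁ + j
  f_v₁ : ∃ j ∈ J, ⁅f, v₁⁆ = j
  v₀_v₁ : ∃ j ∈ J, ⁅v₀, v₁⁆ = j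

/-- Elements of a one-dimensional ideal are annihilated by brackets. -/
theorem lie_lie_eq_zero_of_finrank_one {J : LieIdeal k L} (hJ : finrank k J = 1) (x y : L) {z : L}
    (hz : z ∈ J) : ⁅⁅x, y⁆, z⁆ = 0 := by
  obtain ⟨⟨z₀, hz₀⟩, -, hs⟩ := finrank_eq_one_iff'.1 hJ
  have key : ∀ m ∈ J, ∃ c : k, m = c • z₀ := by
    intro m hm
    obtain ⟨c, hc⟩ := hs ⟨m, hm⟩
    exact ⟨c, (congrArg Subtype.val hc).symm⟩
  obtain ⟨c, rfl⟩ := key z hz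
  obtain ⟨a, ha⟩ := key _ (lie_mem_right k L J x z₀ hz₀)
  obtain ⟨b, hb⟩ := key _ (lie_mem_right k L J y z₀ hz₀)
  rw [lie_smul, lie_lie, hb, ha, lie_smul, lie_smul, ha, hb, smul_comm, sub_self, smul_zero]

theorem lie_eq_zero_of_finrank_one {J : LieIdeal k L} (hJ : finrank k J = 1) {x y : L}
    (hx : x ∈ J) (hy : y ∈ J) : ⁅x, y⁆ = 0 := by
  obtain ⟨⟨z₀, hz₀⟩, -, hs⟩ := finrank_eq_one_iff'.1 hJ
  obtain ⟨a, ha⟩ := hs ⟨x, hx⟩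
  obtain ⟨b, hb⟩ := hs ⟨y, hy⟩
  rw [← show a • z₀ = x from congrArg Subtype.val ha,
    ← show b • z₀ = y from congrArg Subtype.val hb]
  simp

/-- Extensions of `L₁` by a one-dimensional ideal have one of the standard tables. -/
theorem exists_tableType_of_central (h3 : (3 : k) = 0) (hL : finrank k L = 6)
    {J : LieIdeal k L} (hJ : finrank k J = 1) {e h f v₀ v₁ : L} (T : LeviTableMod J e h f v₀ v₁)
    (hgen : ∀ W : Submodule k L, e ∈ W → h ∈ W → f ∈ W → v₀ ∈ W → v₁ ∈ W → (∀ j ∈ J, j ∈ W) →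
      ∀ y, y ∈ W) :
    ∃ t : TableType, HasTableType k L t := by
  have h0 : ∀ m : L, (3 : k) • m = 0 := fun m => by rw [h3, zero_smul]
  obtain ⟨j1, hj1, t1⟩ := T.h_e
  obtain ⟨j2, hj2, t2⟩ := T.h_f
  obtain ⟨j3, hj3, t3⟩ := T.e_f
  obtain ⟨j4, hj4, t4⟩ := T.h_v₀
  obtain ⟨j5, hj5, t5⟩ := T.h_v₁
  obtain ⟨j6, hj6, t6⟩ := T.e_v₀
  obtain ⟨j7, hj7, t7⟩ := T.e_v₁
  obtain ⟨j8, hj8, t8⟩ := T.f_v₀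
  obtain ⟨j9, hj9, t9⟩ := T.f_v₁
  obtain ⟨j10, hj10, t10⟩ := T.v₀_v₁
  -- Brackets act trivially on the line J, and modulo J and one another all five generators are
  -- brackets; hence J is central.
  have hcen : ∀ j ∈ J, ∀ x : L, ⁅x, j⁆ = 0 := by
    intro j hj
    have hbr : ∀ x y : L, ⁅⁅x, y⁆, j⁆ = 0 := fun x y => lie_lie_eq_zero_of_finrank_one hJ x y hj
    have hab : ∀ i ∈ J, ⁅i, j⁆ = 0 := fun i hi => lie_eq_zero_of_finrank_one hJ hi hj
    let W : Submodule k L := LinearMap.ker ((LieModule.toEnd k L L : L →ₗ[k] Module.End k L).flip j)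
    have hW : ∀ x, x ∈ W ↔ ⁅x, j⁆ = 0 := fun x => Iff.rfl
    have w0 : ⁅v₀, j⁆ = 0 := by
      have := hbr h v₀
      rwa [t4, add_lie, hab _ hj4, add_zero] at this
    have w1 : ⁅v₁, j⁆ = 0 := by
      have := hbr f v₀
      rwa [t8, add_lie, hab _ hj8, add_zero] at this
    refine hgen W ?_ ?_ ?_ w0 w1 hab
    · have := hbr h e
      rw [t1, add_lie, add_lie, hab _ hj1, w1, add_zero, add_zero, neg_lie] at this
      exact neg_eq_zero.1 this
    · have := hbr e f
      rwa [t3, add_lie, hab _ hj3, add_zero] at this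
    · have := hbr h f
      rwa [t2, add_lie, hab _ hj2, add_zero] at this
  have hcen' : ∀ j ∈ J, ∀ x : L, ⁅j, x⁆ = 0 := fun j hj x => by
    rw [← lie_skew, hcen j hj, neg_zero]
  -- Each generator is redefined by its own relation, which absorbs the errors j1, j2, j3, j4 and
  -- j8; the Jacobi identity forces the other relations except [e, v₀].
  obtain ⟨e', he'⟩ : ∃ e', e' = e - j1 + j8 := ⟨_, rfl⟩
  obtain ⟨h', hh'⟩ : ∃ h', h' = h + j3 := ⟨_, rfl⟩
  obtain ⟨f', hf'⟩ : ∃ f', f' = f + j2 := ⟨_, rfl⟩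
  obtain ⟨v₀', hv₀'⟩ : ∃ v₀', v₀' = v₀ + j4 := ⟨_, rfl⟩
  obtain ⟨v₁', hv₁'⟩ : ∃ v₁', v₁' = v₁ + j8 := ⟨_, rfl⟩
  have s1 : ⁅h', e'⁆ = -e' + v₁' := by
    simp only [he', hh', hv₁', lie_add, lie_sub, add_lie, hcen' _ hj3, hcen _ hj1, hcen _ hj8, t1]
    abel
  have s2 : ⁅h', f'⁆ = f' := by
    simp only [hf', hh', lie_add, add_lie, hcen' _ hj3, hcen _ hj2, t2, add_zero]
  have s3 : ⁅e', f'⁆ = h' := by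
    simp only [he', hf', hh', lie_add, add_lie, sub_lie, hcen' _ hj1, hcen' _ hj8, hcen _ hj2, t3,
      add_zero, sub_zero]
  have s4 : ⁅h', v₀'⁆ = v₀' := by
    simp only [hv₀', hh', lie_add, add_lie, hcen' _ hj3, hcen _ hj4, t4, add_zero]
  have s8 : ⁅f', v₀'⁆ = v₁' := by
    simp only [hv₀', hf', hv₁', lie_add, add_lie, hcen' _ hj2, hcen _ hj4, t8, add_zero]
  have s5 : ⁅h', v₁'⁆ = -v₁' := by
    have := leibniz_lie h' f' v₀'
    rw [s8, s2, s4, s8] at this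
    linear_combination (norm := module) this + h0 v₁'
  have s6 : ⁅e', v₀'⁆ = j6 := by
    simp only [he', hv₀', lie_add, add_lie, sub_lie, hcen' _ hj1, hcen' _ hj8, hcen _ hj4, t6,
      add_zero, sub_zero]
  -- Since [e, v₀] is central, the Jacobi identity on h, e, v₀ reduces to [v₁, v₀] = 0. This is why
  -- C(0,1) never appears.
  have s10 : ⁅v₀', v₁'⁆ = 0 := by
    have := leibniz_lie h' e' v₀'
    rw [s6, hcen _ hj6, s4, s1, add_lie, neg_lie, ← lie_skew v₁', s6] at this
    linear_combination (norm := module) this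
  have s7 : ⁅e', v₁'⁆ = v₀' := by
    have q1 : ⁅e', v₁'⁆ = v₀ + j7 := by
      simp only [he', hv₁', lie_add, add_lie, sub_lie, hcen' _ hj1, hcen' _ hj8, hcen _ hj8, t7,
        add_zero, sub_zero]
    have q2 : ⁅h', ⁅e', v₁'⁆⁆ = v₀' := by
      rw [q1, lie_add, hcen _ hj7, hh', add_lie, hcen' _ hj3, t4, hv₀', add_zero, add_zero]
    have := leibniz_lie h' e' v₁'
    rw [q2, s1, s5, add_lie, lie_self, neg_lie, lie_neg] at this
    linear_combination (norm := module) h0 ⁅e', v₁'⁆ - this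
  have s9 : ⁅f', v₁'⁆ = 0 := by
    have := leibniz_lie h' e' f'
    rw [s3, lie_self, s1, s2, add_lie, neg_lie, s3, ← lie_skew v₁'] at this
    linear_combination (norm := module) this
  obtain ⟨⟨z, hz⟩, -, hs⟩ := finrank_eq_one_iff'.1 hJ
  have key : ∀ m ∈ J, ∃ c : k, m = c • z := by
    intro m hm
    obtain ⟨c, hc⟩ := hs ⟨m, hm⟩
    exact ⟨c, (congrArg Subtype.val hc).symm⟩
  obtain ⟨α, hα⟩ := key j6 hj6
  have hgen' : ∀ W : Submodule k L, e' ∈ W → h' ∈ W → f' ∈ W → v₀' ∈ W → v₁' ∈ W → z ∈ W →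
      ∀ y, y ∈ W := by
    intro W we wh wf w0 w1 wz
    have wj : ∀ j ∈ J, j ∈ W := by
      intro j hj
      obtain ⟨c, rfl⟩ := key j hj
      exact W.smul_mem _ wz
    refine hgen W ?_ ?_ ?_ ?_ ?_ wj
    · have := W.sub_mem (W.add_mem we (wj _ hj1)) (wj _ hj8)
      rw [he'] at this
      convert this using 1
      abel
    · simpa [hh'] using W.sub_mem wh (wj _ hj3)
    · simpa [hf'] using W.sub_mem wf (wj _ hj2)
    · simpa [hv₀'] using W.sub_mem w0 (wj _ hj4)
    · simpa [hv₁'] using W.sub_mem w1 (wj _ hj8)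
  by_cases hα0 : α = 0
  · obtain ⟨b, hb⟩ := exists_basis_of_generating hL ![e', h', f', v₀', v₁', z]
      (fun W hW => hgen' W (hW 0) (hW 1) (hW 2) (hW 3) (hW 4) (hW 5))
    refine ⟨.central00, e', h', f', v₀', v₁', z, b, hb, ?_, hcen' z hz⟩
    refine ⟨s1, s2, s3, s4, s5, ?_, s7, s8, s9, by rw [s10, zero_smul]⟩
    rw [s6, hα, hα0]
  · obtain ⟨b, hb⟩ := exists_basis_of_generating hL ![e', h', f', v₀', v₁', α • z]
      (fun W hW => hgen' W (hW 0) (hW 1) (hW 2) (hW 3) (hW 4) ((W.smul_mem_iff hα0).1 (hW 5)))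
    refine ⟨.central10, e', h', f', v₀', v₁', α • z, b, hb, ?_, hcen' _ (J.smul_mem _ hz)⟩
    refine ⟨s1, s2, s3, s4, s5, ?_, s7, s8, s9, by rw [s10, zero_smul]⟩
    rw [s6, hα, one_smul]

end TableRecognition

/-! ### The classification, by the ideals contained in the radical. -/

section Classification

variable {k : Type u} {L : Type v} [Field k] [LieRing L] [LieAlgebra k L]

/-- The canonical projection onto the quotient by an ideal, as a homomorphism of Lie algebras. -/
def LieIdeal.quotientHom (J : LieIdeal k L) : L →ₗ⁅k⁆ L ⧸ J :=
  { J.toSubmodule.mkQ with map_lie' := fun {_ _} => rfl }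

namespace LieIdeal

variable (J : LieIdeal k L)

theorem quotientHom_surjective : Function.Surjective J.quotientHom :=
  LieSubmodule.Quotient.surjective_mk' J

theorem quotientHom_eq_zero {x : L} : J.quotientHom x = 0 ↔ x ∈ J :=
  LieSubmodule.Quotient.mk_eq_zero J

variable {J}

theorem toSubmodule_map_quotientHom (I : LieIdeal k L) :
    (I.map J.quotientHom).toSubmodule = I.toSubmodule.map (J.quotientHom : L →ₗ[k] L ⧸ J) :=
  LieIdeal.coe_map_of_surjective J.quotientHom_surjective

theorem quotientHom_mem_map {I : LieIdeal k L} (hJI : J ≤ I) {x : L} :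
    J.quotientHom x ∈ I.map J.quotientHom ↔ x ∈ I := by
  refine ⟨fun hx => ?_, LieIdeal.mem_map⟩
  rw [← LieSubmodule.mem_toSubmodule, toSubmodule_map_quotientHom] at hx
  obtain ⟨y, hy, hyx⟩ := hx
  have : y - x ∈ J := by
    rw [← quotientHom_eq_zero, map_sub]
    exact sub_eq_zero.2 hyx
  have := I.sub_mem hy (hJI this)
  rwa [sub_sub_cancel] at this

theorem exists_of_mem_map_quotientHom {I : LieIdeal k L} {y : L ⧸ J}
    (hy : y ∈ I.map J.quotientHom) : ∃ x ∈ I, J.quotientHom x = y := by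
  rw [← LieSubmodule.mem_toSubmodule, toSubmodule_map_quotientHom] at hy
  exact hy

theorem finrank_map_quotientHom_add [FiniteDimensional k L] {I : LieIdeal k L} (hJI : J ≤ I) :
    finrank k (I.map J.quotientHom) + finrank k J = finrank k I := by
  let g : I.toSubmodule →ₗ[k] L ⧸ J := (J.quotientHom : L →ₗ[k] L ⧸ J).domRestrict I.toSubmodule
  have h1 := LinearMap.finrank_range_add_finrank_ker g
  have h2 : LinearMap.range g = (I.map J.quotientHom).toSubmodule := by
    rw [toSubmodule_map_quotientHom, LinearMap.range_domRestrict]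
  have h3 : (LinearMap.ker g).map I.toSubmodule.subtype = J.toSubmodule := by
    ext x
    constructor
    · rintro ⟨y, hy, rfl⟩
      exact (quotientHom_eq_zero J).1 hy
    · intro hx
      exact ⟨⟨x, hJI hx⟩, (quotientHom_eq_zero J).2 hx, rfl⟩
  have h4 : finrank k (LinearMap.ker g) = finrank k J := by
    rw [← Submodule.finrank_map_subtype_eq, h3]
    rfl
  rw [h2, h4] at h1
  exact h1

theorem eq_of_le_of_finrank_eq [FiniteDimensional k L] {I : LieIdeal k L} (hJI : J ≤ I)
    (h : finrank k J = finrank k I) : J = I := by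
  rw [← LieSubmodule.toSubmodule_inj]
  exact Submodule.eq_of_le_of_finrank_eq hJI h

theorem eq_bot_of_finrank_eq_zero [FiniteDimensional k L] (h : finrank k J = 0) : J = ⊥ := by
  rw [← LieSubmodule.toSubmodule_inj]
  exact Submodule.finrank_eq_zero.1 h

end LieIdeal

/-- An extension of a solvable Lie algebra by a solvable ideal is solvable. -/
theorem LieAlgebra.isSolvable_of_quotient (I : LieIdeal k L) (hI : LieAlgebra.IsSolvable I)
    (hQ : LieAlgebra.IsSolvable (L ⧸ I)) : LieAlgebra.IsSolvable L := by
  obtain ⟨n, hn⟩ := (LieAlgebra.isSolvable_iff k _).1 hI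
  obtain ⟨m, hm⟩ := (LieAlgebra.isSolvable_iff k _).1 hQ
  refine LieAlgebra.IsSolvable.mk (R := k) (k := n + m) ?_
  rw [LieIdeal.derivedSeries_eq_bot_iff] at hn
  have h1 := LieIdeal.derivedSeries_map_eq m I.quotientHom_surjective
  rw [hm, LieIdeal.map_eq_bot_iff] at h1
  rw [LieAlgebra.derivedSeries_def, LieAlgebra.derivedSeriesOfIdeal_add, eq_bot_iff, ← hn]
  refine LieAlgebra.derivedSeriesOfIdeal_mono (fun x hx => ?_) n
  exact I.quotientHom_eq_zero.1 (h1 hx)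

/-- The elements `e, h, f` can be changed by elements of `I` so that they satisfy the relations of
the standard basis of `sl(2)` modulo `J`. -/
def HasSlLiftMod (I J : LieIdeal k L) (e h f : L) : Prop :=
  ∃ e' h' f' : L, e' - e ∈ I ∧ h' - h ∈ I ∧ f' - f ∈ I ∧ SlTripleMod J e' h' f'

theorem HasSlLiftMod.mono {R I J : LieIdeal k L} {e h f e' h' f' : L} (hIR : I ≤ R)
    (he : e' - e ∈ R) (hh : h' - h ∈ R) (hf : f' - f ∈ R) (H : HasSlLiftMod I J e' h' f') :
    HasSlLiftMod R J e h f := by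
  obtain ⟨e'', h'', f'', q1, q2, q3, q4⟩ := H
  refine ⟨e'', h'', f'', ?_, ?_, ?_, q4⟩
  · simpa using R.add_mem (hIR q1) he
  · simpa using R.add_mem (hIR q2) hh
  · simpa using R.add_mem (hIR q3) hf

namespace SlTripleMod

variable {I J : LieIdeal k L} {e h f : L}

theorem map_quotientHom (H : SlTripleMod I e h f) : SlTripleMod (I.map J.quotientHom)
    (J.quotientHom e) (J.quotientHom h) (J.quotientHom f) where
  h_e := by
    rw [← LieHom.map_lie, ← map_smul, ← map_sub]
    exact LieIdeal.mem_map H.h_e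
  h_f := by
    rw [← LieHom.map_lie, ← map_smul, ← map_add]
    exact LieIdeal.mem_map H.h_f
  e_f := by
    rw [← LieHom.map_lie, ← map_sub]
    exact LieIdeal.mem_map H.e_f

theorem of_hasSlLift_quotient (hJI : J ≤ I)
    (H : HasSlLift (I.map J.quotientHom) (J.quotientHom e) (J.quotientHom h) (J.quotientHom f)) :
    HasSlLiftMod I J e h f := by
  obtain ⟨e', h', f', q1, q2, q3, q4, q5, q6⟩ := H
  obtain ⟨e', rfl⟩ := J.quotientHom_surjective e'
  obtain ⟨h', rfl⟩ := J.quotientHom_surjective h'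
  obtain ⟨f', rfl⟩ := J.quotientHom_surjective f'
  rw [← map_sub, LieIdeal.quotientHom_mem_map hJI] at q1 q2 q3
  refine ⟨e', h', f', q1, q2, q3, ?_, ?_, ?_⟩
  · rw [← J.quotientHom_eq_zero, map_sub, LieHom.map_lie, map_smul, q4, sub_self]
  · rw [← J.quotientHom_eq_zero, map_add, LieHom.map_lie, map_smul, q5, neg_add_cancel]
  · rw [← J.quotientHom_eq_zero, map_sub, LieHom.map_lie, q6, sub_self]

theorem of_hasSlLift (H : HasSlLift I e h f) : HasSlLiftMod I ⊥ e h f := by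
  obtain ⟨e', h', f', q1, q2, q3, q4, q5, q6⟩ := H
  refine ⟨e', h', f', q1, q2, q3, ?_, ?_, ?_⟩
  · simp [q4]
  · simp [q5]
  · simp [q6]

/-- One-dimensional ideals are trivial modules. -/
theorem lie_eq_zero_of_finrank_one (H : SlTripleMod I e h f) (h2 : (2 : k) ≠ 0)
    (hI : finrank k I = 1) {m : L} (hm : m ∈ I) : ⁅e, m⁆ = 0 ∧ ⁅h, m⁆ = 0 ∧ ⁅f, m⁆ = 0 := by
  have hab : ∀ x ∈ I, ∀ y ∈ I, ⁅x, y⁆ = 0 := fun x hx y hy =>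
    _root_.lie_eq_zero_of_finrank_one hI hx hy
  have hh : ⁅h, m⁆ = 0 := by
    have := _root_.lie_lie_eq_zero_of_finrank_one hI e f hm
    rwa [← sub_add_cancel ⁅e, f⁆ h, add_lie, hab _ H.e_f m hm, zero_add] at this
  refine ⟨?_, hh, ?_⟩
  · have := _root_.lie_lie_eq_zero_of_finrank_one hI h e hm
    rw [← sub_add_cancel ⁅h, e⁆ ((2 : k) • e), add_lie, hab _ H.h_e m hm, zero_add, smul_lie] at this
    exact (smul_eq_zero.1 this).resolve_left h2
  · have := _root_.lie_lie_eq_zero_of_finrank_one hI h f hm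
    rw [← add_sub_cancel_right ⁅h, f⁆ ((2 : k) • f), sub_lie, hab _ H.h_f m hm, zero_sub,
      smul_lie, neg_eq_zero] at this
    exact (smul_eq_zero.1 this).resolve_left h2

/-- Extensions by one-dimensional modules split. -/
theorem hasSlLiftMod_of_finrank [FiniteDimensional k L] (H : SlTripleMod I e h f)
    (h2 : (2 : k) ≠ 0) (hJI : J ≤ I)
    (hd : finrank k I = finrank k J + 1) : HasSlLiftMod I J e h f := by
  have h1 : finrank k (I.map J.quotientHom) = 1 := by
    have := LieIdeal.finrank_map_quotientHom_add hJI
    omega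
  have H' := H.map_quotientHom (J := J)
  exact of_hasSlLift_quotient hJI (H'.hasSlLift_of_trivial h2
    (fun x hx y hy => _root_.lie_eq_zero_of_finrank_one h1 hx hy)
    (fun x hx => (H'.lie_eq_zero_of_finrank_one h2 h1 hx).1)
    (fun x hx => (H'.lie_eq_zero_of_finrank_one h2 h1 hx).2.1)
    (fun x hx => (H'.lie_eq_zero_of_finrank_one h2 h1 hx).2.2))

end SlTripleMod

/-- The descent step: relations that hold modulo I are improved to hold modulo J. -/
theorem HasSlLiftMod.trans_of_finrank [FiniteDimensional k L] {R I J : LieIdeal k L} {e h f : L}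
    (H : HasSlLiftMod R I e h f) (h2 : (2 : k) ≠ 0) (hJI : J ≤ I) (hIR : I ≤ R)
    (hd : finrank k I = finrank k J + 1) : HasSlLiftMod R J e h f := by
  obtain ⟨e', h', f', q1, q2, q3, q4⟩ := H
  exact (q4.hasSlLiftMod_of_finrank h2 hJI hd).mono hIR q1 q2 q3

/-- A lift of the standard basis of `L / R` gives a section of the canonical projection. -/
theorem exists_section_of_hasSlLiftMod {R : LieIdeal k L} {e h f : L} (b : Basis (Fin 3) k (L ⧸ R))
    (he : R.quotientHom e = b 0) (hh : R.quotientHom h = b 1) (hf : R.quotientHom f = b 2)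
    (H : HasSlLiftMod R ⊥ e h f) :
    ∃ s : L ⧸ R →ₗ⁅k⁆ L, ∀ q, LieSubmodule.Quotient.mk (N := R) (s q) = q := by
  obtain ⟨e', h', f', q1, q2, q3, q4, q5, q6⟩ := H
  rw [← R.quotientHom_eq_zero, map_sub, sub_eq_zero] at q1 q2 q3
  rw [LieSubmodule.mem_bot, sub_eq_zero] at q4 q6
  rw [LieSubmodule.mem_bot, add_eq_zero_iff_eq_neg] at q5
  rw [he] at q1
  rw [hh] at q2
  rw [hf] at q3
  have r4 : ⁅b 1, b 0⁆ = (2 : k) • b 0 := by rw [← q1, ← q2, ← LieHom.map_lie, q4, map_smul]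
  have r5 : ⁅b 1, b 2⁆ = -((2 : k) • b 2) := by
    rw [← q3, ← q2, ← LieHom.map_lie, q5, map_neg, map_smul]
  have r6 : ⁅b 0, b 2⁆ = b 1 := by rw [← q1, ← q2, ← q3, ← LieHom.map_lie, q6]
  let s : L ⧸ R →ₗ[k] L := b.constr k ![e', h', f']
  have s0 : s (b 0) = e' := by simp [s]
  have s1 : s (b 1) = h' := by simp [s]
  have s2 : s (b 2) = f' := by simp [s]
  have key : ∀ x y : L ⧸ R, s ⁅x, y⁆ = ⁅s x, s y⁆ := by
    intro x y
    rw [← b.sum_repr x, ← b.sum_repr y, Fin.sum_univ_three, Fin.sum_univ_three]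
    simp only [lie_add, add_lie, lie_smul, smul_lie, map_add, map_smul, lie_self, s0, s1, s2]
    rw [← lie_skew (b 0) (b 1), ← lie_skew (b 2) (b 1), ← lie_skew (b 2) (b 0), r4, r5, r6,
      ← lie_skew e' h', ← lie_skew f' h', ← lie_skew f' e', q4, q5, q6]
    simp only [map_neg, map_smul, s0, s1, s2, neg_neg, map_zero]
  refine ⟨{ s with map_lie' := fun {x y} => key x y }, fun q => ?_⟩
  have : (R.quotientHom : L →ₗ[k] L ⧸ R) ∘ₗ s = LinearMap.id := by
    refine b.ext fun i => ?_
    fin_cases i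
    · simpa [s0] using q1
    · simpa [s1] using q2
    · simpa [s2] using q3
  exact LinearMap.congr_fun this q

/-- An ideal of the radical which equals its derived ideal is zero. -/
theorem eq_bot_of_lie_eq_self [FiniteDimensional k L] {I : LieIdeal k L}
    (hI : I ≤ LieAlgebra.radical k L) (h : ⁅I, I⁆ = I) : I = ⊥ := by
  have : LieAlgebra.IsSolvable I := LieAlgebra.le_solvable_ideal_solvable hI inferInstance
  obtain ⟨n, hn⟩ := (LieAlgebra.isSolvable_iff k I).1 this
  rw [LieIdeal.derivedSeries_eq_bot_iff] at hn
  rw [← hn]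
  clear hn
  induction n with
  | zero => rfl
  | succ n ih => rw [LieAlgebra.derivedSeriesOfIdeal_succ, ← ih, h]

/-- If `[R, R] + J = R` for the radical `R`, then `J = R`. -/
theorem radical_le_of_le_lie_sup [FiniteDimensional k L] {J : LieIdeal k L}
    (h : LieAlgebra.radical k L ≤ ⁅LieAlgebra.radical k L, LieAlgebra.radical k L⁆ ⊔ J) :
    LieAlgebra.radical k L ≤ J := by
  set R := LieAlgebra.radical k L with hR
  have hsol : LieAlgebra.IsSolvable R := inferInstance
  obtain ⟨n, hn⟩ := (LieAlgebra.isSolvable_iff k R).1 hsol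
  rw [LieIdeal.derivedSeries_eq_bot_iff] at hn
  have key : ∀ n, R ≤ LieAlgebra.derivedSeriesOfIdeal k L n R ⊔ J := by
    intro n
    induction n with
    | zero => exact le_sup_left
    | succ n ih =>
      refine h.trans (sup_le ?_ le_sup_right)
      -- Deriving the inductive hypothesis once puts [R, R] into the next derived ideal plus J.
      have h1 := LieAlgebra.derivedSeriesOfIdeal_mono ih 1
      rw [add_comm n 1, LieAlgebra.derivedSeriesOfIdeal_add]
      exact h1.trans
        (LieAlgebra.derivedSeriesOfIdeal_add_le_add (LieAlgebra.derivedSeriesOfIdeal k L n R) J 1 0)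
  have := key n
  rwa [hn, bot_sup_eq] at this

/-- An ideal of the radical all of whose proper subideals are zero is abelian. -/
theorem lie_eq_zero_of_minimal [FiniteDimensional k L] {I : LieIdeal k L}
    (hI : I ≤ LieAlgebra.radical k L) (hmin : ∀ J : LieIdeal k L, J ≤ I → J = ⊥ ∨ J = I) :
    ∀ x ∈ I, ∀ y ∈ I, ⁅x, y⁆ = 0 := by
  have h0 : ⁅I, I⁆ = (⊥ : LieIdeal k L) := by
    rcases hmin ⁅I, I⁆ (LieSubmodule.lie_le_right _ _) with h | h
    · exact h
    · rw [h]
      exact eq_bot_of_lie_eq_self hI h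
  rw [LieSubmodule.lie_eq_bot_iff] at h0
  exact h0

/-- Nonsplit six-dimensional extensions by a three-dimensional radical. -/
theorem exists_tableType_of_not_splits [Finite k] {p : ℕ} [CharP k p] (hp : 3 ≤ p)
    (hL : finrank k L = 6) (hns : ¬ LieAlgebra.IsSolvable L)
    (hR3 : finrank k (LieAlgebra.radical k L) = 3) (hsplit : ¬ RadicalExtensionSplits k L) :
    p = 3 ∧ ∃ t : TableType, HasTableType k L t := by
  have hfin : FiniteDimensional k L := FiniteDimensional.of_finrank_pos (by omega)
  have hsol : LieAlgebra.IsSolvable (LieAlgebra.radical k L) := inferInstance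
  have hcon : ∀ (e h f : L) (b : Basis (Fin 3) k (L ⧸ LieAlgebra.radical k L)),
      (LieAlgebra.radical k L).quotientHom e = b 0 →
      (LieAlgebra.radical k L).quotientHom h = b 1 →
      (LieAlgebra.radical k L).quotientHom f = b 2 →
      ¬ HasSlLiftMod (LieAlgebra.radical k L) ⊥ e h f := fun e h f b he hh hf H =>
    hsplit (exists_section_of_hasSlLiftMod b he hh hf H)
  have hmin0 : ∀ I : LieIdeal k L, I ≤ LieAlgebra.radical k L →
      (∀ J : LieIdeal k L, J ≤ I → J = ⊥ ∨ J = I) → ∀ x ∈ I, ∀ y ∈ I, ⁅x, y⁆ = 0 :=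
    fun I => lie_eq_zero_of_minimal
  have hsup := fun J : LieIdeal k L => radical_le_of_le_lie_sup (J := J)
  clear hsplit
  generalize LieAlgebra.radical k L = R at *
  have hpp : p.Prime := (CharP.char_is_prime_or_zero k p).resolve_right (by omega)
  have h2 : (2 : k) ≠ 0 := by
    intro h
    have := (CharP.cast_eq_zero_iff k p 2).1 (by exact_mod_cast h)
    exact absurd (Nat.le_of_dvd (by norm_num) this) (by omega)
  have hp3 : (3 : k) = 0 → p = 3 := by
    intro h
    have := (CharP.cast_eq_zero_iff k p 3).1 (by exact_mod_cast h)
    have := Nat.le_of_dvd (by norm_num) this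
    omega
  have hS : finrank k (L ⧸ R) = 3 := by
    have := Submodule.finrank_quotient_add_finrank R.toSubmodule
    have h1 : finrank k (L ⧸ R.toSubmodule) = finrank k (L ⧸ R) := rfl
    have h2 : finrank k R.toSubmodule = finrank k R := rfl
    omega
  obtain ⟨b, b1, b2, b3⟩ := exists_sl2_basis h2 hS
    (fun h => hns (LieAlgebra.isSolvable_of_quotient R hsol h))
  obtain ⟨e, he⟩ := R.quotientHom_surjective (b 0)
  obtain ⟨h, hh⟩ := R.quotientHom_surjective (b 1)
  obtain ⟨f, hf⟩ := R.quotientHom_surjective (b 2)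
  have hno := hcon e h f b he hh hf
  have H : SlTripleMod R e h f := by
    constructor
    · rw [← R.quotientHom_eq_zero, map_sub, map_smul, LieHom.map_lie, he, hh, b1, sub_self]
    · rw [← R.quotientHom_eq_zero, map_add, map_smul, LieHom.map_lie, hf, hh, b2, neg_add_cancel]
    · rw [← R.quotientHom_eq_zero, map_sub, LieHom.map_lie, he, hf, hh, b3, sub_self]
  have Hrefl : HasSlLiftMod R R e h f := ⟨e, h, f, by simp, by simp, by simp, H⟩
  have hgen : ∀ W : Submodule k L, e ∈ W → h ∈ W → f ∈ W → (∀ m ∈ R, m ∈ W) → ∀ y, y ∈ W := by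
    intro W we wh wf wR y
    have hy := b.sum_repr (R.quotientHom y)
    rw [Fin.sum_univ_three, ← he, ← hf, ← hh] at hy
    simp only [← map_smul, ← map_add] at hy
    rw [eq_comm, ← sub_eq_zero, ← map_sub, R.quotientHom_eq_zero] at hy
    rw [← sub_add_cancel y]
    exact W.add_mem (wR _ hy) (W.add_mem (W.add_mem (W.smul_mem _ we) (W.smul_mem _ wh))
      (W.smul_mem _ wf))
  have hbot : finrank k (⊥ : LieIdeal k L) = 0 := finrank_bot k L
  have hle : ∀ I J : LieIdeal k L, I ≤ J → finrank k I ≤ finrank k J :=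
    fun I J hIJ => Submodule.finrank_mono hIJ
  -- A full flag of ideals in R would give a lift through three one-dimensional layers.
  by_cases hA : ∃ J I : LieIdeal k L, J ≤ I ∧ I ≤ R ∧ finrank k J = 1 ∧ finrank k I = 2
  · obtain ⟨J, I, hJI, hIR, hJ, hI⟩ := hA
    exact absurd (((Hrefl.trans_of_finrank h2 hIR le_rfl (by omega)).trans_of_finrank h2 hJI hIR
      (by omega)).trans_of_finrank h2 bot_le (hJI.trans hIR) (by omega)) hno
  push Not at hA
  by_cases hB : ∃ J : LieIdeal k L, J ≤ R ∧ finrank k J = 1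
  · obtain ⟨J, hJR, hJ⟩ := hB
    -- No ideal of dimension 2 lies between J and R, and [R, R] + J = R is impossible for solvable R
    -- ≠ J.
    have hder : ⁅R, R⁆ ≤ J := by
      have h1 : ⁅R, R⁆ ⊔ J ≤ R := sup_le (LieSubmodule.lie_le_right _ _) hJR
      have h4 := hle _ _ h1
      have h5 := hle _ _ (le_sup_right : J ≤ ⁅R, R⁆ ⊔ J)
      have h6 := hA J (⁅R, R⁆ ⊔ J) le_sup_right h1 hJ
      have h7 : finrank k (⁅R, R⁆ ⊔ J : LieIdeal k L) ≠ 3 := by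
        intro h7
        have h8 := LieIdeal.eq_of_le_of_finrank_eq h1 (h7.trans hR3.symm)
        have := hle _ _ (hsup J h8.ge)
        omega
      have h8 : J = ⁅R, R⁆ ⊔ J := LieIdeal.eq_of_le_of_finrank_eq le_sup_right (by omega)
      rw [h8]
      exact le_sup_left
    have hV : finrank k (R.map J.quotientHom) = 2 := by
      have := LieIdeal.finrank_map_quotientHom_add hJR
      omega
    have hab : ∀ x ∈ R.map J.quotientHom, ∀ y ∈ R.map J.quotientHom, ⁅x, y⁆ = 0 := by
      intro x hx y hy
      obtain ⟨x, hx', rfl⟩ := LieIdeal.exists_of_mem_map_quotientHom hx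
      obtain ⟨y, hy', rfl⟩ := LieIdeal.exists_of_mem_map_quotientHom hy
      rw [← LieHom.map_lie, J.quotientHom_eq_zero]
      exact hder (LieSubmodule.lie_mem_lie hx' hy')
    rcases (H.map_quotientHom (J := J)).hasSlLift_or_leviTable h2 hab hV with hl | ⟨h3, hl⟩
    · exact absurd ((SlTripleMod.of_hasSlLift_quotient hJR hl).trans_of_finrank h2 bot_le hJR
        (by omega)) hno
    refine ⟨hp3 h3, ?_⟩
    obtain ⟨e', h', f', v₀, v₁, T, -, -, hspan, se, sh, sf⟩ := hl
    obtain ⟨e', rfl⟩ := J.quotientHom_surjective e'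
    obtain ⟨h', rfl⟩ := J.quotientHom_surjective h'
    obtain ⟨f', rfl⟩ := J.quotientHom_surjective f'
    obtain ⟨v₀, rfl⟩ := J.quotientHom_surjective v₀
    obtain ⟨v₁, rfl⟩ := J.quotientHom_surjective v₁
    have aux : ∀ x y : L, J.quotientHom x = J.quotientHom y → ∃ j ∈ J, x = y + j := by
      intro x y hxy
      rw [← sub_eq_zero, ← map_sub, J.quotientHom_eq_zero] at hxy
      exact ⟨_, hxy, by abel⟩
    have aux0 : ∀ x : L, J.quotientHom x = 0 → ∃ j ∈ J, x = j := fun x hx =>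
      ⟨x, (J.quotientHom_eq_zero).1 hx, rfl⟩
    have T' : LeviTableMod J e' h' f' v₀ v₁ := by
      constructor
      · exact aux _ _ (by rw [LieHom.map_lie, T.h_e, map_add, map_neg])
      · exact aux _ _ (by rw [LieHom.map_lie, T.h_f])
      · exact aux _ _ (by rw [LieHom.map_lie, T.e_f])
      · exact aux _ _ (by rw [LieHom.map_lie, T.h_v₀])
      · exact aux _ _ (by rw [LieHom.map_lie, T.h_v₁, map_neg])
      · exact aux0 _ (by rw [LieHom.map_lie, T.e_v₀])
      · exact aux _ _ (by rw [LieHom.map_lie, T.e_v₁])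
      · exact aux _ _ (by rw [LieHom.map_lie, T.f_v₀])
      · exact aux0 _ (by rw [LieHom.map_lie, T.f_v₁])
      · exact aux0 _ (by rw [LieHom.map_lie, T.v₀_v₁])
    refine exists_tableType_of_central h3 hL hJ T' fun W we wh wf w0 w1 wJ => ?_
    have hW : ∀ x : L, J.quotientHom x ∈ W.map (J.quotientHom : L →ₗ[k] L ⧸ J) → x ∈ W := by
      rintro x ⟨y, hy, hyx⟩
      obtain ⟨j, hj, rfl⟩ := aux x y hyx.symm
      exact W.add_mem hy (wJ j hj)
    have hspan5 : ∀ x ∈ Submodule.span k {J.quotientHom e', J.quotientHom h', J.quotientHom f',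
        J.quotientHom v₀, J.quotientHom v₁}, x ∈ W.map (J.quotientHom : L →ₗ[k] L ⧸ J) := by
      intro x hx
      refine Submodule.span_le.2 ?_ hx
      rintro y (rfl | rfl | rfl | rfl | rfl)
      exacts [⟨_, we, rfl⟩, ⟨_, wh, rfl⟩, ⟨_, wf, rfl⟩, ⟨_, w0, rfl⟩, ⟨_, w1, rfl⟩]
    refine hgen W (hW _ (hspan5 _ se)) (hW _ (hspan5 _ sh)) (hW _ (hspan5 _ sf)) fun m hm => ?_
    refine hW _ (hspan5 _ (Submodule.span_mono ?_ (hspan _ (LieIdeal.mem_map hm))))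
    rintro y (rfl | rfl) <;> simp
  push Not at hB
  by_cases hC : ∃ V : LieIdeal k L, V ≤ R ∧ finrank k V = 2
  · obtain ⟨V, hVR, hV⟩ := hC
    -- Without one-dimensional ideals in R, the plane V is minimal and hence abelian.
    have hab : ∀ x ∈ V, ∀ y ∈ V, ⁅x, y⁆ = 0 := by
      refine hmin0 V hVR fun J hJ => ?_
      have h1 := hle _ _ hJ
      have h4 := hB J (hJ.trans hVR)
      by_cases h5 : finrank k J = 0
      · exact Or.inl (LieIdeal.eq_bot_of_finrank_eq_zero h5)
      · exact Or.inr (LieIdeal.eq_of_le_of_finrank_eq hJ (by omega))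
    obtain ⟨e₁, h₁, f₁, q1, q2, q3, q4⟩ := Hrefl.trans_of_finrank h2 hVR le_rfl (by omega)
    rcases q4.hasSlLift_or_leviTable h2 hab hV with hl | ⟨h3, hl⟩
    · exact absurd ((SlTripleMod.of_hasSlLift hl).mono hVR q1 q2 q3) hno
    refine ⟨hp3 h3, ?_⟩
    obtain ⟨e', h', f', v₀, v₁, T, hv₀, hv₁, hspan, se, sh, sf⟩ := hl
    have hV1 : finrank k (R.map V.quotientHom) = 1 := by
      have := LieIdeal.finrank_map_quotientHom_add hVR
      omega
    have h0 : ∀ m : L, (3 : k) • m = 0 := fun m => by rw [h3, zero_smul]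
    have HV : SlTripleMod V e' h' f' := by
      constructor
      · rw [T.h_e, show -e' + v₁ - (2 : k) • e' = v₁ - (3 : k) • e' by module, h0, sub_zero]
        exact hv₁
      · rw [T.h_f, show f' + (2 : k) • f' = (3 : k) • f' by module, h0]
        exact V.zero_mem
      · rw [T.e_f, sub_self]
        exact V.zero_mem
    have HR : SlTripleMod (R.map V.quotientHom) (V.quotientHom e') (V.quotientHom h')
        (V.quotientHom f') := by
      have := HV.map_quotientHom (J := V)
      exact ⟨LieIdeal.map_mono hVR this.h_e, LieIdeal.map_mono hVR this.h_f,
        LieIdeal.map_mono hVR this.e_f⟩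
    obtain ⟨⟨d₀, hd₀⟩, -, hd⟩ := finrank_eq_one_iff'.1 hV1
    obtain ⟨d, hdR, rfl⟩ := LieIdeal.exists_of_mem_map_quotientHom hd₀
    have hRd : ∀ m ∈ R, ∃ c : k, m - c • d ∈ V := by
      intro m hm
      obtain ⟨c, hc⟩ := hd ⟨_, LieIdeal.mem_map hm⟩
      have hc' : c • V.quotientHom d = V.quotientHom m := congrArg Subtype.val hc
      refine ⟨c, ?_⟩
      rw [← V.quotientHom_eq_zero, map_sub, map_smul, hc', sub_self]
    have hdV : ∀ x : L, ⁅V.quotientHom x, V.quotientHom d⁆ = 0 →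
        ⁅d, x⁆ ∈ Submodule.span k {v₀, v₁} := by
      intro x hx
      refine hspan _ ?_
      rw [← V.quotientHom_eq_zero, LieHom.map_lie, ← lie_skew, hx, neg_zero]
    -- R/V is a line, hence a trivial module: d brackets e', h', f' into V.
    obtain ⟨r1, r2, r3⟩ := HR.lie_eq_zero_of_finrank_one h2 hV1 hd₀
    refine exists_tableType_of_derivation h2 h3 hL T (hdV _ r1) (hdV _ r2) (hdV _ r3)
      (hspan _ (lie_mem_right k L V d v₀ hv₀)) fun W wd we wh wf w0 w1 => ?_
    have hspan5 : ∀ x ∈ Submodule.span k {e', h', f', v₀, v₁}, x ∈ W := by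
      intro x hx
      refine Submodule.span_le.2 ?_ hx
      rintro y (rfl | rfl | rfl | rfl | rfl) <;> assumption
    have wV : ∀ m ∈ V, m ∈ W := by
      intro m hm
      refine hspan5 _ (Submodule.span_mono ?_ (hspan _ hm))
      rintro y (rfl | rfl) <;> simp
    have wR : ∀ m ∈ R, m ∈ W := by
      intro m hm
      obtain ⟨c, hc⟩ := hRd m hm
      have := W.add_mem (wV _ hc) (W.smul_mem c wd)
      rwa [sub_add_cancel] at this
    have wsub : ∀ x y : L, y - x ∈ R → y ∈ W → x ∈ W := by
      intro x y hxy hy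
      have := W.sub_mem hy (wR _ hxy)
      rwa [sub_sub_cancel] at this
    exact hgen W (wsub _ _ q1 (hspan5 _ se)) (wsub _ _ q2 (hspan5 _ sh))
      (wsub _ _ q3 (hspan5 _ sf)) wR
  push Not at hC
  have hminR : ∀ J : LieIdeal k L, J ≤ R → J = ⊥ ∨ J = R := by
    intro J hJ
    have h1 := hle _ _ hJ
    have h4 := hB J hJ
    have h5 := hC J hJ
    by_cases h6 : finrank k J = 0
    · exact Or.inl (LieIdeal.eq_bot_of_finrank_eq_zero h6)
    · exact Or.inr (LieIdeal.eq_of_le_of_finrank_eq hJ (by omega))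
  have hab := hmin0 R le_rfl hminR
  refine absurd (SlTripleMod.of_hasSlLift (H.hasSlLift_of_irreducible hab hp hR3 ?_)) hno
  intro W hWR we wh wf
  -- R is abelian, so a subspace of R stable under e, h and f is an ideal of L.
  have hW : ∀ x m : L, m ∈ W → ⁅x, m⁆ ∈ W := by
    intro x m hm
    refine hgen (W.comap ((LieModule.toEnd k L L : L →ₗ[k] Module.End k L).flip m)) (we m hm)
      (wh m hm) (wf m hm) (fun y hy => ?_) x
    change ⁅y, m⁆ ∈ W
    rw [hab y hy m (hWR m hm)]
    exact W.zero_mem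
  rcases hminR { W with lie_mem := fun {x m} hm => hW x m hm } (fun m hm => hWR m hm) with h1 | h1
  · left
    rw [← LieSubmodule.toSubmodule_inj] at h1
    exact h1
  · right
    intro m hm
    rw [← h1] at hm
    exact hm

end Classification

/-! ### Invariants separating the types. -/

section Invariants

variable {k : Type u} [Field k] {L : Type v} [LieRing L] [LieAlgebra k L]

/-- The Jacobi identity on h, e, v₀ gives [v₁, v₀] = 0, whereas the table demands -z. -/
theorem not_isCentralExtensionOfL₁_zero_one : ¬ IsCentralExtensionOfL₁ k L 0 1 := by
  rintro ⟨e, h, f, v₀, v₁, z, b, hb, T, hz⟩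
  have := leibniz_lie h e v₀
  rw [T.e_v₀, zero_smul, lie_zero, T.h_e, T.h_v₀, T.e_v₀, zero_smul, add_lie, neg_lie, T.e_v₀,
    T.v₁_v₀] at this
  have hz0 : z = 0 := by simpa using this
  have h5 := b.ne_zero 5
  rw [hb] at h5
  exact h5 hz0

/-- A nonzero central element exists. -/
def HasCentralElement (L : Type v) [LieRing L] : Prop := ∃ z : L, z ≠ 0 ∧ ∀ x : L, ⁅z, x⁆ = 0

/-- The derived algebra is contained in a hyperplane. -/
def IsImperfect (k : Type u) (L : Type v) [Field k] [LieRing L] [LieAlgebra k L] : Prop :=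
  ∃ φ : L →ₗ[k] k, φ ≠ 0 ∧ ∀ x y : L, φ ⁅x, y⁆ = 0

/-- The cube of the adjoint endomorphism of `x` is inner. -/
def HasInnerCube (x : L) : Prop := ∃ y : L, ∀ z : L, ⁅x, ⁅x, ⁅x, z⁆⁆⁆ = ⁅y, z⁆

/-- The elements with inner cube are closed under the bracket. -/
def InnerCubesClosed (L : Type v) [LieRing L] : Prop :=
  ∀ x y : L, HasInnerCube x → HasInnerCube y → HasInnerCube ⁅x, y⁆

variable {M : Type w} [LieRing M] [LieAlgebra k M]

theorem HasCentralElement.congr (E : L ≃ₗ⁅k⁆ M) (h : HasCentralElement L) :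
    HasCentralElement M := by
  obtain ⟨z, hz, hc⟩ := h
  refine ⟨E z, fun h0 => hz (E.injective (show E z = E 0 by rw [h0, map_zero])), fun x => ?_⟩
  obtain ⟨x, rfl⟩ : ∃ x', E x' = x := E.surjective x
  rw [← LieEquiv.map_lie, hc, map_zero]

theorem IsImperfect.congr (E : L ≃ₗ⁅k⁆ M) (h : IsImperfect k L) : IsImperfect k M := by
  obtain ⟨φ, hφ, hc⟩ := h
  refine ⟨φ ∘ₗ (E.symm : M →ₗ[k] L), fun h0 => hφ ?_, fun x y => ?_⟩
  · ext x
    simpa using LinearMap.congr_fun h0 (E x)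
  · have := hc (E.symm x) (E.symm y)
    rw [← LieEquiv.map_lie] at this
    exact this

theorem HasInnerCube.map (E : L ≃ₗ⁅k⁆ M) {x : L} (h : HasInnerCube x) : HasInnerCube (E x) := by
  obtain ⟨y, hy⟩ := h
  refine ⟨E y, fun z => ?_⟩
  obtain ⟨z, rfl⟩ : ∃ z', E z' = z := E.surjective z
  simp only [← LieEquiv.map_lie, hy]

theorem InnerCubesClosed.congr (E : L ≃ₗ⁅k⁆ M) (h : InnerCubesClosed L) :
    InnerCubesClosed M := by
  intro x y hx hy
  have := (h _ _ (hx.map E.symm) (hy.map E.symm)).map E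
  rwa [LieEquiv.map_lie, E.apply_symm_apply, E.apply_symm_apply] at this

/-- Jacobson's formula in characteristic three. -/
theorem HasInnerCube.add (h3 : (3 : k) = 0) {x y : L} (hx : HasInnerCube x) (hy : HasInnerCube y) :
    HasInnerCube (x + y) := by
  have h0 : ∀ m : L, (3 : k) • m = 0 := fun m => by rw [h3, zero_smul]
  obtain ⟨x', hx⟩ := hx
  obtain ⟨y', hy⟩ := hy
  refine ⟨x' + y' + ⁅x, ⁅x, y⁆⁆ + ⁅y, ⁅y, x⁆⁆, fun z => ?_⟩
  have e1 : ⁅⁅x, ⁅x, y⁆⁆, z⁆ = ⁅x, ⁅x, ⁅y, z⁆⁆⁆ - (2 : k) • ⁅x, ⁅y, ⁅x, z⁆⁆⁆ + ⁅y, ⁅x, ⁅x, z⁆⁆⁆ := by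
    rw [lie_lie, lie_lie, lie_lie, lie_sub]
    module
  have e2 : ⁅⁅y, ⁅y, x⁆⁆, z⁆ = ⁅y, ⁅y, ⁅x, z⁆⁆⁆ - (2 : k) • ⁅y, ⁅x, ⁅y, z⁆⁆⁆ + ⁅x, ⁅y, ⁅y, z⁆⁆⁆ := by
    rw [lie_lie, lie_lie, lie_lie, lie_sub]
    module
  simp only [add_lie, lie_add, hx, hy, e1, e2]
  linear_combination (norm := module) h0 ⁅x, ⁅y, ⁅x, z⁆⁆⁆ + h0 ⁅y, ⁅x, ⁅y, z⁆⁆⁆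

theorem HasInnerCube.smul (c : k) {x : L} (hx : HasInnerCube x) : HasInnerCube (c • x) := by
  obtain ⟨x', hx⟩ := hx
  refine ⟨c ^ 3 • x', fun z => ?_⟩
  simp only [smul_lie, lie_smul, hx]
  module

/-- It suffices to verify an inner cube on a basis. -/
theorem hasInnerCube_of_basis (b : Basis (Fin 6) k L) {x : L} (y : L)
    (h : ∀ i, ⁅x, ⁅x, ⁅x, b i⁆⁆⁆ = ⁅y, b i⁆) : HasInnerCube x := by
  refine ⟨y, fun z => ?_⟩
  have : (LieAlgebra.ad k L x) ∘ₗ (LieAlgebra.ad k L x) ∘ₗ (LieAlgebra.ad k L x) =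
      LieAlgebra.ad k L y := b.ext h
  exact LinearMap.congr_fun this z

theorem IsCentralExtensionOfL₁.hasCentralElement {α β : k} (H : IsCentralExtensionOfL₁ k L α β) :
    HasCentralElement L := by
  obtain ⟨e, h, f, v₀, v₁, z, b, hb, T, hz⟩ := H
  have h5 := b.ne_zero 5
  rw [hb] at h5
  exact ⟨z, h5, hz⟩

/-- The linear form is the coordinate of z, which occurs in no bracket. -/
theorem IsCentralExtensionOfL₁.isImperfect (H : IsCentralExtensionOfL₁ k L 0 0) :
    IsImperfect k L := by
  obtain ⟨e, h, f, v₀, v₁, z, b, hb, T, hz⟩ := H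
  have hz' : ∀ x, ⁅x, z⁆ = 0 := fun x => by rw [← lie_skew, hz, neg_zero]
  rw [zero_smul] at T
  refine ⟨b.coord 5, fun h0 => ?_, ?_⟩
  · have := LinearMap.congr_fun h0 (b 5)
    simp at this
  have c : ∀ i, i ≠ 5 → b.coord 5 (b i) = 0 := fun i hi => by
    rw [b.coord_apply, b.repr_self, Finsupp.single_eq_of_ne hi.symm]
  have c0 := c 0 (by decide)
  have c1 := c 1 (by decide)
  have c2 := c 2 (by decide)
  have c3 := c 3 (by decide)
  have c4 := c 4 (by decide)
  simp only [hb, Matrix.cons_val] at c0 c1 c2 c3 c4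
  intro x y
  rw [← b.sum_repr x, ← b.sum_repr y]
  simp only [Fin.sum_univ_six, hb, Matrix.cons_val]
  simp only [lie_add, add_lie, lie_smul, smul_lie, map_add, map_smul, map_neg, map_sub, map_zero,
    lie_self, hz, hz', T.h_e, T.h_f, T.e_f, T.h_v₀, T.h_v₁, T.e_v₀, T.e_v₁, T.f_v₀, T.f_v₁,
    T.v₀_v₁, T.e_h, T.f_h, T.f_e, T.v₀_h, T.v₁_h, T.v₀_e, T.v₁_e, T.v₀_f, T.v₁_f, T.v₁_v₀, c0, c1,
    c2, c3, c4, smul_zero, add_zero, neg_zero, sub_zero]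

theorem IsCentralExtensionOfL₁.not_isImperfect {α β : k} (hα : α ≠ 0)
    (H : IsCentralExtensionOfL₁ k L α β) : ¬ IsImperfect k L := by
  obtain ⟨e, h, f, v₀, v₁, z, b, hb, T, hz⟩ := H
  rintro ⟨φ, hφ, hc⟩
  have p1 : φ f = 0 := by rw [← T.h_f, hc]
  have p2 : φ h = 0 := by rw [← T.e_f, hc]
  have p3 : φ v₀ = 0 := by rw [← T.h_v₀, hc]
  have p4 : φ v₁ = 0 := by rw [← T.f_v₀, hc]
  have p5 : φ e = 0 := by
    have := hc h e
    rwa [T.h_e, map_add, p4, add_zero, map_neg, neg_eq_zero] at this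
  have p6 : φ z = 0 := by
    have := hc e v₀
    rw [T.e_v₀, map_smul] at this
    exact (smul_eq_zero.1 this).resolve_left hα
  apply hφ
  refine b.ext fun i => ?_
  rw [hb]
  fin_cases i <;> assumption

/-- The derivation extensions of `L₁`, with the ideal forgotten. -/
structure DerivationTable (α β : k) (d e h f v₀ v₁ : L) : Prop extends
    LeviTable e h f v₀ v₁ 0 0 where
  d_e : ⁅d, e⁆ = α • v₁
  d_f : ⁅d, f⁆ = β • v₀
  d_h : ⁅d, h⁆ = 0
  d_v₀ : ⁅d, v₀⁆ = 0
  d_v₁ : ⁅d, v₁⁆ = 0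

namespace DerivationTable

variable {α β : k} {d e h f v₀ v₁ : L}

theorem e_d (T : DerivationTable α β d e h f v₀ v₁) : ⁅e, d⁆ = -(α • v₁) := by
  rw [← lie_skew, T.d_e]

theorem f_d (T : DerivationTable α β d e h f v₀ v₁) : ⁅f, d⁆ = -(β • v₀) := by
  rw [← lie_skew, T.d_f]

theorem h_d (T : DerivationTable α β d e h f v₀ v₁) : ⁅h, d⁆ = 0 := by
  rw [← lie_skew, T.d_h, neg_zero]

theorem v₀_d (T : DerivationTable α β d e h f v₀ v₁) : ⁅v₀, d⁆ = 0 := by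
  rw [← lie_skew, T.d_v₀, neg_zero]

theorem v₁_d (T : DerivationTable α β d e h f v₀ v₁) : ⁅v₁, d⁆ = 0 := by
  rw [← lie_skew, T.d_v₁, neg_zero]

variable {b : Basis (Fin 6) k L}

theorem v₀_ne_zero (hb : ⇑b = ![d, e, h, f, v₀, v₁]) : v₀ ≠ 0 := by
  have := b.ne_zero 4
  rwa [hb] at this

theorem v₁_ne_zero (hb : ⇑b = ![d, e, h, f, v₀, v₁]) : v₁ ≠ 0 := by
  have := b.ne_zero 5
  rwa [hb] at this

theorem eq_zero_of_smul_add (hb : ⇑b = ![d, e, h, f, v₀, v₁]) {x y : k}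
    (hxy : x • v₀ + y • v₁ = 0) : x = 0 ∧ y = 0 := by
  have := Fintype.linearIndependent_iff.1 b.linearIndependent ![0, 0, 0, 0, x, y]
    (by rw [hb]; simpa [Fin.sum_univ_succ] using hxy)
  exact ⟨this 4, this 5⟩

theorem exists_coord (hb : ⇑b = ![d, e, h, f, v₀, v₁]) (x : L) : x = b.coord 0 x • d +
    b.coord 1 x • e + b.coord 2 x • h + b.coord 3 x • f + b.coord 4 x • v₀ + b.coord 5 x • v₁ := by
  conv_lhs => rw [← b.sum_repr x]
  simp only [Fin.sum_univ_six, hb, Matrix.cons_val, b.coord_apply]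

/-- The centralizer of `h, v₀, v₁` is spanned by `d`. -/
theorem eq_smul_of_centralizes (T : DerivationTable α β d e h f v₀ v₁)
    (hb : ⇑b = ![d, e, h, f, v₀, v₁]) {x : L} (hh : ⁅x, h⁆ = 0) (h0 : ⁅x, v₀⁆ = 0)
    (h1 : ⁅x, v₁⁆ = 0) : ∃ c : k, x = c • d := by
  have hx := exists_coord hb x
  generalize b.coord 0 x = c0, b.coord 1 x = c1, b.coord 2 x = c2, b.coord 3 x = c3,
    b.coord 4 x = c4, b.coord 5 x = c5 at hx
  subst hx
  simp only [add_lie, smul_lie, T.d_v₀, T.e_v₀, T.h_v₀, T.f_v₀, lie_self, T.v₁_v₀, smul_zero,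
    neg_zero, zero_add, add_zero] at h0
  obtain ⟨rfl, rfl⟩ := eq_zero_of_smul_add hb h0
  simp only [add_lie, smul_lie, T.d_v₁, T.e_v₁, lie_self, T.v₀_v₁, smul_zero,
    zero_smul, zero_add, add_zero] at h1
  have hc1 : c1 = 0 := by simpa [v₀_ne_zero hb] using h1
  subst hc1
  simp only [add_lie, smul_lie, T.d_h, T.v₀_h, T.v₁_h, smul_zero, zero_smul, zero_add,
    add_zero] at hh
  obtain ⟨h4, rfl⟩ := eq_zero_of_smul_add hb (x := -c4) (y := c5) (by rw [← hh]; module)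
  obtain rfl := neg_eq_zero.1 h4
  exact ⟨c0, by module⟩

/-- A central element is a multiple of d, and d moves e or f. -/
theorem not_hasCentralElement (T : DerivationTable α β d e h f v₀ v₁)
    (hb : ⇑b = ![d, e, h, f, v₀, v₁]) (hαβ : α ≠ 0 ∨ β ≠ 0) : ¬ HasCentralElement L := by
  rintro ⟨z, hz, hc⟩
  obtain ⟨c, rfl⟩ := T.eq_smul_of_centralizes hb (hc h) (hc v₀) (hc v₁)
  have he := hc e
  have hf := hc f
  rw [smul_lie, T.d_e] at he
  rw [smul_lie, T.d_f] at hf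
  have hc0 : c ≠ 0 := fun h0 => hz (by rw [h0, zero_smul])
  rcases hαβ with h0 | h0
  · simp [hc0, h0, v₁_ne_zero hb] at he
  · simp [hc0, h0, v₀_ne_zero hb] at hf

theorem hasInnerCube (hb : ⇑b = ![d, e, h, f, v₀, v₁]) {x : L} (y : L)
    (hd : ⁅x, ⁅x, ⁅x, d⁆⁆⁆ = ⁅y, d⁆) (he : ⁅x, ⁅x, ⁅x, e⁆⁆⁆ = ⁅y, e⁆)
    (hh : ⁅x, ⁅x, ⁅x, h⁆⁆⁆ = ⁅y, h⁆) (hf : ⁅x, ⁅x, ⁅x, f⁆⁆⁆ = ⁅y, f⁆)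
    (h0 : ⁅x, ⁅x, ⁅x, v₀⁆⁆⁆ = ⁅y, v₀⁆) (h1 : ⁅x, ⁅x, ⁅x, v₁⁆⁆⁆ = ⁅y, v₁⁆) : HasInnerCube x := by
  refine hasInnerCube_of_basis b y fun i => ?_
  rw [hb]
  fin_cases i <;> assumption

/-- The elements with inner cube are exactly the span of d, h, f, v₀, v₁, which is a subalgebra. For
e the cube sends f to -v₀ and kills h, v₀, v₁; only a multiple of d could induce it, but here [d, f]
= 0. -/
theorem innerCubesClosed (T : DerivationTable (1 : k) 0 d e h f v₀ v₁) (h3 : (3 : k) = 0)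
    (hb : ⇑b = ![d, e, h, f, v₀, v₁]) : InnerCubesClosed L := by
  have h0 : ∀ m : L, (3 : k) • m = 0 := fun m => by rw [h3, zero_smul]
  have Qd : HasInnerCube d := hasInnerCube hb 0 (by simp)
    (by simp [T.d_e, T.d_v₁]) (by simp [T.d_h]) (by simp [T.d_f]) (by simp [T.d_v₀])
    (by simp [T.d_v₁])
  have Qf : HasInnerCube f := hasInnerCube hb 0 (by simp [T.f_d])
    (by simp [T.f_e, T.f_h]) (by simp [T.f_h]) (by simp) (by simp [T.f_v₀, T.f_v₁])
    (by simp [T.f_v₁])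
  have Q0 : HasInnerCube v₀ := hasInnerCube hb 0 (by simp [T.v₀_d])
    (by simp [T.v₀_e]) (by simp [T.v₀_h]) (by simp [T.v₀_f, T.v₀_v₁]) (by simp)
    (by simp [T.v₀_v₁])
  have Q1 : HasInnerCube v₁ := hasInnerCube hb 0 (by simp [T.v₁_d])
    (by simp [T.v₁_e, T.v₁_v₀]) (by simp [T.v₁_h]) (by simp [T.v₁_f]) (by simp [T.v₁_v₀])
    (by simp)
  have Qh : HasInnerCube h := hasInnerCube hb (h - d) (by simp [T.h_d])
    (by
      simp only [T.h_e, T.d_e, T.h_v₁, lie_add, lie_neg, sub_lie]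
      linear_combination (norm := module) h0 v₁)
    (by simp [T.d_h]) (by simp [T.h_f, T.d_f]) (by simp [T.h_v₀, T.d_v₀])
    (by simp [T.h_v₁, T.d_v₁])
  have Q : ∀ c0 c2 c3 c4 c5 : k,
      HasInnerCube (c0 • d + c2 • h + c3 • f + c4 • v₀ + c5 • v₁) := fun c0 c2 c3 c4 c5 =>
    ((((Qd.smul c0).add h3 (Qh.smul c2)).add h3 (Qf.smul c3)).add h3 (Q0.smul c4)).add h3
      (Q1.smul c5)
  have hcoord : ∀ x : L, HasInnerCube x →
      ∃ c0 c2 c3 c4 c5 : k, x = c0 • d + c2 • h + c3 • f + c4 • v₀ + c5 • v₁ := by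
    intro x hx
    have hx' := exists_coord hb x
    generalize b.coord 0 x = c0, b.coord 1 x = c1, b.coord 2 x = c2, b.coord 3 x = c3,
      b.coord 4 x = c4, b.coord 5 x = c5 at hx'
    -- Removing the components known to have inner cubes isolates the multiple of e.
    have hQe := hx.add h3 (Q (-c0) (-c2) (-c3) (-c4) (-c5))
    have hxe : x + (-c0 • d + -c2 • h + -c3 • f + -c4 • v₀ + -c5 • v₁) = c1 • e := by
      rw [hx']; module
    rw [hxe] at hQe
    obtain ⟨y, hy⟩ := hQe
    have yf := hy f
    obtain ⟨c, rfl⟩ := T.eq_smul_of_centralizes hb (x := y)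
      (by rw [← hy]; simp [T.e_h, T.e_v₁, T.e_v₀])
      (by rw [← hy]; simp [T.e_v₀]) (by rw [← hy]; simp [T.e_v₁, T.e_v₀])
    simp only [smul_lie, lie_smul, T.e_f, T.e_h, T.d_f, lie_sub, lie_self, T.e_v₁, zero_smul,
      smul_zero, zero_sub] at yf
    have hc1 : c1 = 0 := by simpa [v₀_ne_zero hb] using yf
    refine ⟨c0, c2, c3, c4, c5, ?_⟩
    rw [hx', hc1]
    module
  intro x y hx hy
  obtain ⟨c0, c2, c3, c4, c5, rfl⟩ := hcoord x hx
  obtain ⟨a0, a2, a3, a4, a5, rfl⟩ := hcoord y hy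
  convert Q 0 0 (c2 * a3 - c3 * a2) (c2 * a4 - c4 * a2) (c5 * a2 - c2 * a5 + c3 * a4 - c4 * a3)
    using 1
  simp only [lie_add, add_lie, lie_smul, smul_lie, lie_self, T.d_h, T.d_f, T.d_v₀, T.d_v₁, T.h_d,
    T.f_d, T.v₀_d, T.v₁_d, T.h_f, T.h_v₀, T.h_v₁, T.f_v₀, T.f_v₁, T.v₀_v₁, T.f_h, T.v₀_h, T.v₁_h,
    T.v₀_f, T.v₁_f, T.v₁_v₀]
  module

/-- Here -d induces the cube of e and 0 that of f, but h = [e, f] has no inner cube: (ad h)³ e = -e,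
while the only candidates h + c d send e to -e + v₁. -/
theorem not_innerCubesClosed (T : DerivationTable (0 : k) 1 d e h f v₀ v₁) (h3 : (3 : k) = 0)
    (hb : ⇑b = ![d, e, h, f, v₀, v₁]) : ¬ InnerCubesClosed L := by
  have h0 : ∀ m : L, (3 : k) • m = 0 := fun m => by rw [h3, zero_smul]
  have Qe : HasInnerCube e := hasInnerCube hb (-d) (by simp [T.e_d])
    (by simp [T.d_e]) (by simp [T.d_h, T.e_h, T.e_v₁, T.e_v₀])
    (by simp [T.e_f, T.e_h, T.e_v₁, T.d_f]) (by simp [T.d_v₀, T.e_v₀])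
    (by simp [T.d_v₁, T.e_v₁, T.e_v₀])
  have Qf : HasInnerCube f := hasInnerCube hb 0
    (by simp [T.f_d, T.f_v₀, T.f_v₁])
    (by simp [T.f_e, T.f_h]) (by simp [T.f_h]) (by simp) (by simp [T.f_v₀, T.f_v₁])
    (by simp [T.f_v₁])
  intro hclosed
  obtain ⟨y, hy⟩ := hclosed e f Qe Qf
  rw [T.e_f] at hy
  obtain ⟨c, hc⟩ := T.eq_smul_of_centralizes hb (x := y - h)
    (by rw [sub_lie, ← hy]; simp) (by rw [sub_lie, ← hy]; simp [T.h_v₀])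
    (by rw [sub_lie, ← hy]; simp [T.h_v₁])
  have he := congrArg (⁅·, e⁆) hc
  simp only [sub_lie, ← hy, smul_lie, T.d_e, T.h_e, lie_add, lie_neg, T.h_v₁, zero_smul,
    smul_zero] at he
  apply v₁_ne_zero hb
  linear_combination (norm := module) h0 v₁ - he

end DerivationTable

theorem IsDerivationExtensionOfL₁.exists_derivationTable {α β : k}
    (H : IsDerivationExtensionOfL₁ k L α β) : ∃ (d e h f v₀ v₁ : L) (b : Basis (Fin 6) k L),
      ⇑b = ![d, e, h, f, v₀, v₁] ∧ DerivationTable α β d e h f v₀ v₁ := by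
  obtain ⟨d, e, h, f, v₀, v₁, b, -, hb, -, -, T, q1, q2, q3, q4, q5⟩ := H
  exact ⟨d, e, h, f, v₀, v₁, b, hb, T, q1, q2, q3, q4, q5⟩

end Invariants

/-! ### Pairwise nonisomorphism of the types. -/

section Nonisomorphism

variable {k : Type u} [Field k] {A : Type v} {B : Type w} [LieRing A] [LieAlgebra k A]
  [LieRing B] [LieAlgebra k B]

theorem IsDerivationExtensionOfL₁.not_hasCentralElement {α β : k} (hαβ : α ≠ 0 ∨ β ≠ 0)
    (H : IsDerivationExtensionOfL₁ k A α β) : ¬ HasCentralElement A := by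
  obtain ⟨d, e, h, f, v₀, v₁, b, hb, T⟩ := H.exists_derivationTable
  exact T.not_hasCentralElement hb hαβ

/-- Algebras with different tables are not isomorphic. -/
theorem HasTableType.isEmpty_lieEquiv (h3 : (3 : k) = 0) {s t : TableType} (hst : s ≠ t)
    (hA : HasTableType k A s) (hB : HasTableType k B t) : IsEmpty (A ≃ₗ⁅k⁆ B) := by
  refine ⟨fun E => ?_⟩
  have cd : ∀ {α β γ δ : k}, γ ≠ 0 ∨ δ ≠ 0 → IsCentralExtensionOfL₁ k A α β →
      IsDerivationExtensionOfL₁ k B γ δ → False := fun h hA hB =>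
    hB.not_hasCentralElement h (hA.hasCentralElement.congr E)
  have dc : ∀ {α β γ δ : k}, γ ≠ 0 ∨ δ ≠ 0 → IsDerivationExtensionOfL₁ k A γ δ →
      IsCentralExtensionOfL₁ k B α β → False := fun h hA hB =>
    hA.not_hasCentralElement h (hB.hasCentralElement.congr E.symm)
  cases s <;> cases t <;> simp only [HasTableType] at hA hB
  · exact hst rfl
  · exact not_isCentralExtensionOfL₁_zero_one hB
  · exact hB.not_isImperfect one_ne_zero (hA.isImperfect.congr E)
  · exact cd (Or.inl one_ne_zero) hA hB
  · exact cd (Or.inr one_ne_zero) hA hB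
  · exact not_isCentralExtensionOfL₁_zero_one hA
  · exact not_isCentralExtensionOfL₁_zero_one hA
  · exact not_isCentralExtensionOfL₁_zero_one hA
  · exact not_isCentralExtensionOfL₁_zero_one hA
  · exact not_isCentralExtensionOfL₁_zero_one hA
  · exact hA.not_isImperfect one_ne_zero (hB.isImperfect.congr E.symm)
  · exact not_isCentralExtensionOfL₁_zero_one hB
  · exact hst rfl
  · exact cd (Or.inl one_ne_zero) hA hB
  · exact cd (Or.inr one_ne_zero) hA hB
  · exact dc (Or.inl one_ne_zero) hA hB
  · exact dc (Or.inl one_ne_zero) hA hB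
  · exact dc (Or.inl one_ne_zero) hA hB
  · exact hst rfl
  · obtain ⟨_, _, _, _, _, _, b, hb, T⟩ := hA.exists_derivationTable
    obtain ⟨_, _, _, _, _, _, b', hb', T'⟩ := hB.exists_derivationTable
    exact T'.not_innerCubesClosed h3 hb' ((T.innerCubesClosed h3 hb).congr E)
  · exact dc (Or.inr one_ne_zero) hA hB
  · exact dc (Or.inr one_ne_zero) hA hB
  · exact dc (Or.inr one_ne_zero) hA hB
  · obtain ⟨_, _, _, _, _, _, b, hb, T⟩ := hA.exists_derivationTable
    obtain ⟨_, _, _, _, _, _, b', hb', T'⟩ := hB.exists_derivationTable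
    exact T.not_innerCubesClosed h3 hb ((T'.innerCubesClosed h3 hb').congr E.symm)
  · exact hst rfl

end Nonisomorphism

/-! ### Explicit models in coordinates. -/

section Models

/-- The coordinate space carrying the multiplication of the central extension of `L₁` with
`[e, v₀] = α z`, in the basis `e, h, f, v₀, v₁, z`. -/
def CentralModel (k : Type u) (_α : k) : Type u := Fin 6 → k

/-- The coordinate space carrying the multiplication of the extension of `L₁` by a derivation with
`[d, e] = α v₁` and `[d, f] = β v₀`, in the basis `d, e, h, f, v₀, v₁`. -/
def DerivationModel (k : Type u) (_α _β : k) : Type u := Fin 6 → k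

variable {k : Type u} [Field k]

/-- A subspace of the coordinate space containing the standard basis is everything. -/
theorem forall_mem_of_single_mem (W : Submodule k (Fin 6 → k)) (h0 : Pi.single 0 1 ∈ W)
    (h1 : Pi.single 1 1 ∈ W) (h2 : Pi.single 2 1 ∈ W) (h3 : Pi.single 3 1 ∈ W)
    (h4 : Pi.single 4 1 ∈ W) (h5 : Pi.single 5 1 ∈ W) (y : Fin 6 → k) : y ∈ W := by
  have hW : ∀ i, (Pi.basisFun k (Fin 6)) i ∈ W := by
    intro i
    rw [Pi.basisFun_apply]
    fin_cases i <;> assumption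
  rw [← (Pi.basisFun k (Fin 6)).sum_repr y]
  exact W.sum_mem fun i _ => W.smul_mem _ (hW i)

namespace CentralModel

variable {α : k}

instance : AddCommGroup (CentralModel k α) := inferInstanceAs (AddCommGroup (Fin 6 → k))

instance : Module k (CentralModel k α) := inferInstanceAs (Module k (Fin 6 → k))

/-- The multiplication in coordinates. -/
def bracket (α : k) (x y : Fin 6 → k) : Fin 6 → k :=
  ![x 0 * y 1 - x 1 * y 0, x 0 * y 2 - x 2 * y 0, x 1 * y 2 - x 2 * y 1,
    (x 1 * y 3 - x 3 * y 1) + (x 0 * y 4 - x 4 * y 0),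
    (x 1 * y 0 - x 0 * y 1) - (x 1 * y 4 - x 4 * y 1) + (x 2 * y 3 - x 3 * y 2),
    α * (x 0 * y 3 - x 3 * y 0)]

theorem bracket_add_left (x y z : Fin 6 → k) :
    bracket α (x + y) z = bracket α x z + bracket α y z := by
  ext i
  fin_cases i <;> simp [bracket] <;> ring

theorem bracket_add_right (x y z : Fin 6 → k) :
    bracket α x (y + z) = bracket α x y + bracket α x z := by
  ext i
  fin_cases i <;> simp [bracket] <;> ring

theorem bracket_self (x : Fin 6 → k) : bracket α x x = 0 := by
  ext i
  fin_cases i <;> simp [bracket, mul_comm]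

theorem bracket_smul_right (c : k) (x y : Fin 6 → k) :
    bracket α x (c • y) = c • bracket α x y := by
  ext i
  fin_cases i <;> simp [bracket] <;> ring

/-- The identity is formal except in the coordinates of v₀ and v₁, where the defect is 3 times a 3 ×
3 determinant up to sign. -/
theorem bracket_leibniz [CharP k 3] (x y z : Fin 6 → k) : bracket α x (bracket α y z) =
    bracket α (bracket α x y) z + bracket α y (bracket α x z) := by
  have h3 : (3 : k) = 0 := by exact_mod_cast CharP.cast_eq_zero k 3
  ext i
  fin_cases i <;> simp [bracket]
  · ring
  · ring
  · ring
  · linear_combination (x 1 * y 0 * z 4 - x 1 * y 4 * z 0 - x 0 * y 1 * z 4 + x 0 * y 4 * z 1 +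
      x 4 * y 1 * z 0 - x 4 * y 0 * z 1) * h3
  · linear_combination (-x 1 * y 2 * z 3 + x 1 * y 3 * z 2 + x 2 * y 1 * z 3 - x 2 * y 3 * z 1 -
      x 3 * y 1 * z 2 + x 3 * y 2 * z 1) * h3
  · ring

instance [CharP k 3] : LieRing (CentralModel k α) where
  bracket := bracket α
  add_lie := bracket_add_left
  lie_add := bracket_add_right
  lie_self := bracket_self
  leibniz_lie := bracket_leibniz

instance [CharP k 3] : LieAlgebra k (CentralModel k α) where
  lie_smul := bracket_smul_right

theorem finrank_eq : finrank k (CentralModel k α) = 6 :=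
  (finrank_fin_fun k).trans rfl

theorem h_e : bracket α (Pi.single 1 1) (Pi.single 0 1) = -Pi.single 0 1 + Pi.single 4 1 := by
  ext i
  fin_cases i <;> simp [bracket]

theorem h_f : bracket α (Pi.single 1 1) (Pi.single 2 1) = Pi.single 2 1 := by
  ext i
  fin_cases i <;> simp [bracket]

theorem e_f : bracket α (Pi.single 0 1) (Pi.single 2 1) = Pi.single 1 1 := by
  ext i
  fin_cases i <;> simp [bracket]

theorem h_v₀ : bracket α (Pi.single 1 1) (Pi.single 3 1) = Pi.single 3 1 := by
  ext i
  fin_cases i <;> simp [bracket]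

theorem h_v₁ : bracket α (Pi.single 1 1) (Pi.single 4 1) = -Pi.single 4 1 := by
  ext i
  fin_cases i <;> simp [bracket]

theorem e_v₀ : bracket α (Pi.single 0 1) (Pi.single 3 1) = α • Pi.single 5 1 := by
  ext i
  fin_cases i <;> simp [bracket]

theorem e_v₁ : bracket α (Pi.single 0 1) (Pi.single 4 1) = Pi.single 3 1 := by
  ext i
  fin_cases i <;> simp [bracket]

theorem f_v₀ : bracket α (Pi.single 2 1) (Pi.single 3 1) = Pi.single 4 1 := by
  ext i
  fin_cases i <;> simp [bracket]

theorem f_v₁ : bracket α (Pi.single 2 1) (Pi.single 4 1) = 0 := by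
  ext i
  fin_cases i <;> simp [bracket]

theorem v₀_v₁ : bracket α (Pi.single 3 1) (Pi.single 4 1) = 0 := by
  ext i
  fin_cases i <;> simp [bracket]

theorem central (x : Fin 6 → k) : bracket α (Pi.single 5 1) x = 0 := by
  ext i
  fin_cases i <;> simp [bracket]

theorem isCentralExtensionOfL₁ [CharP k 3] :
    IsCentralExtensionOfL₁ k (CentralModel k α) α 0 := by
  let s : Fin 6 → CentralModel k α := fun i => (Pi.single i 1 : Fin 6 → k)
  obtain ⟨b, hb⟩ := exists_basis_of_generating (k := k) finrank_eq ![s 0, s 1, s 2, s 3, s 4, s 5]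
    (fun W hW => forall_mem_of_single_mem W (hW 0) (hW 1) (hW 2) (hW 3) (hW 4) (hW 5))
  exact ⟨s 0, s 1, s 2, s 3, s 4, s 5, b, hb, ⟨h_e, h_f, e_f, h_v₀, h_v₁, e_v₀, e_v₁, f_v₀, f_v₁,
    v₀_v₁.trans (zero_smul k _).symm⟩, central⟩

end CentralModel

namespace DerivationModel

variable {α β : k}

instance : AddCommGroup (DerivationModel k α β) := inferInstanceAs (AddCommGroup (Fin 6 → k))

instance : Module k (DerivationModel k α β) := inferInstanceAs (Module k (Fin 6 → k))

/-- The multiplication in coordinates. -/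
def bracket (α β : k) (x y : Fin 6 → k) : Fin 6 → k :=
  ![0, x 1 * y 2 - x 2 * y 1, x 1 * y 3 - x 3 * y 1, x 2 * y 3 - x 3 * y 2,
    β * (x 0 * y 3 - x 3 * y 0) + (x 2 * y 4 - x 4 * y 2) + (x 1 * y 5 - x 5 * y 1),
    α * (x 0 * y 1 - x 1 * y 0) + (x 2 * y 1 - x 1 * y 2) - (x 2 * y 5 - x 5 * y 2) +
      (x 3 * y 4 - x 4 * y 3)]

theorem bracket_add_left (x y z : Fin 6 → k) :
    bracket α β (x + y) z = bracket α β x z + bracket α β y z := by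
  ext i
  fin_cases i <;> simp [bracket] <;> ring

theorem bracket_add_right (x y z : Fin 6 → k) :
    bracket α β x (y + z) = bracket α β x y + bracket α β x z := by
  ext i
  fin_cases i <;> simp [bracket] <;> ring

theorem bracket_self (x : Fin 6 → k) : bracket α β x x = 0 := by
  ext i
  fin_cases i <;> simp [bracket, mul_comm]

theorem bracket_smul_right (c : k) (x y : Fin 6 → k) :
    bracket α β x (c • y) = c • bracket α β x y := by
  ext i
  fin_cases i <;> simp [bracket] <;> ring

theorem bracket_leibniz [CharP k 3] (x y z : Fin 6 → k) : bracket α β x (bracket α β y z) =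
    bracket α β (bracket α β x y) z + bracket α β y (bracket α β x z) := by
  have h3 : (3 : k) = 0 := by exact_mod_cast CharP.cast_eq_zero k 3
  ext i
  fin_cases i <;> simp [bracket]
  · ring
  · ring
  · ring
  · linear_combination (x 2 * y 1 * z 5 - x 2 * y 5 * z 1 - x 1 * y 2 * z 5 + x 1 * y 5 * z 2 +
      x 5 * y 2 * z 1 - x 5 * y 1 * z 2) * h3
  · linear_combination (-x 2 * y 3 * z 4 + x 2 * y 4 * z 3 + x 3 * y 2 * z 4 - x 3 * y 4 * z 2 -
      x 4 * y 2 * z 3 + x 4 * y 3 * z 2) * h3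

instance [CharP k 3] : LieRing (DerivationModel k α β) where
  bracket := bracket α β
  add_lie := bracket_add_left
  lie_add := bracket_add_right
  lie_self := bracket_self
  leibniz_lie := bracket_leibniz

instance [CharP k 3] : LieAlgebra k (DerivationModel k α β) where
  lie_smul := bracket_smul_right

theorem finrank_eq : finrank k (DerivationModel k α β) = 6 :=
  (finrank_fin_fun k).trans rfl

theorem h_e : bracket α β (Pi.single 2 1) (Pi.single 1 1) = -Pi.single 1 1 + Pi.single 5 1 := by
  ext i
  fin_cases i <;> simp [bracket]

theorem h_f : bracket α β (Pi.single 2 1) (Pi.single 3 1) = Pi.single 3 1 := by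
  ext i
  fin_cases i <;> simp [bracket]

theorem e_f : bracket α β (Pi.single 1 1) (Pi.single 3 1) = Pi.single 2 1 := by
  ext i
  fin_cases i <;> simp [bracket]

theorem h_v₀ : bracket α β (Pi.single 2 1) (Pi.single 4 1) = Pi.single 4 1 := by
  ext i
  fin_cases i <;> simp [bracket]

theorem h_v₁ : bracket α β (Pi.single 2 1) (Pi.single 5 1) = -Pi.single 5 1 := by
  ext i
  fin_cases i <;> simp [bracket]

theorem e_v₀ : bracket α β (Pi.single 1 1) (Pi.single 4 1) = 0 := by
  ext i
  fin_cases i <;> simp [bracket]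

theorem e_v₁ : bracket α β (Pi.single 1 1) (Pi.single 5 1) = Pi.single 4 1 := by
  ext i
  fin_cases i <;> simp [bracket]

theorem f_v₀ : bracket α β (Pi.single 3 1) (Pi.single 4 1) = Pi.single 5 1 := by
  ext i
  fin_cases i <;> simp [bracket]

theorem f_v₁ : bracket α β (Pi.single 3 1) (Pi.single 5 1) = 0 := by
  ext i
  fin_cases i <;> simp [bracket]

theorem v₀_v₁ : bracket α β (Pi.single 4 1) (Pi.single 5 1) = 0 := by
  ext i
  fin_cases i <;> simp [bracket]

theorem d_e : bracket α β (Pi.single 0 1) (Pi.single 1 1) = α • Pi.single 5 1 := by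
  ext i
  fin_cases i <;> simp [bracket]

theorem d_f : bracket α β (Pi.single 0 1) (Pi.single 3 1) = β • Pi.single 4 1 := by
  ext i
  fin_cases i <;> simp [bracket]

theorem d_h : bracket α β (Pi.single 0 1) (Pi.single 2 1) = 0 := by
  ext i
  fin_cases i <;> simp [bracket]

theorem d_v₀ : bracket α β (Pi.single 0 1) (Pi.single 4 1) = 0 := by
  ext i
  fin_cases i <;> simp [bracket]

theorem d_v₁ : bracket α β (Pi.single 0 1) (Pi.single 5 1) = 0 := by
  ext i
  fin_cases i <;> simp [bracket]

theorem isDerivationExtensionOfL₁ [CharP k 3] :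
    IsDerivationExtensionOfL₁ k (DerivationModel k α β) α β := by
  let s : Fin 6 → DerivationModel k α β := fun i => (Pi.single i 1 : Fin 6 → k)
  have T : LeviTable (s 1) (s 2) (s 3) (s 4) (s 5) 0 0 :=
    ⟨h_e, h_f, e_f, h_v₀, h_v₁, e_v₀, e_v₁, f_v₀, f_v₁, v₀_v₁⟩
  exact isDerivationExtensionOfL₁_of_generating (d := s 0) finrank_eq T d_e d_f d_h d_v₀ d_v₁
    fun W => forall_mem_of_single_mem W

end DerivationModel

end Models

/-! ### The theorem. -/

theorem theorem6p4 (k : Type u) [Field k] [Finite k] (p : ℕ) [CharP k p] (hp : 3 ≤ p) :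
    -- the classification
    (∀ (L : Type v) [LieRing L] [LieAlgebra k L],
      Module.finrank k L = 6 →
      ¬ LieAlgebra.IsSolvable L →
      Module.finrank k (LieAlgebra.radical k L) = 3 →
      ¬ RadicalExtensionSplits k L →
      p = 3 ∧ ∃ t : TableType, HasTableType k L t) ∧
    -- algebras with different tables are not isomorphic
    (p = 3 → ∀ (A : Type v) (B : Type w) [LieRing A] [LieAlgebra k A] [LieRing B] [LieAlgebra k B]
      (s t : TableType), s ≠ t → HasTableType k A s → HasTableType k B t →
      IsEmpty (A ≃ₗ⁅k⁆ B)) ∧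
    -- four of the tables define Lie algebras, the remaining one violates the Jacobi identity
    (p = 3 → ∀ t : TableType, t ≠ TableType.central01 →
      ∃ (A : Type u) (_ : LieRing A) (_ : LieAlgebra k A), HasTableType k A t) ∧
    (∀ (A : Type v) [LieRing A] [LieAlgebra k A], ¬ HasTableType k A TableType.central01) := by
  refine ⟨fun L _ _ hL hns hR hsplit => exists_tableType_of_not_splits hp hL hns hR hsplit, ?_, ?_,
    fun A _ _ => not_isCentralExtensionOfL₁_zero_one⟩
  · rintro rfl A B _ _ _ _ s t hst hA hB
    exact hA.isEmpty_lieEquiv (by exact_mod_cast CharP.cast_eq_zero k 3) hst hB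
  · rintro rfl t ht
    cases t
    · exact ⟨CentralModel k 0, inferInstance, inferInstance, CentralModel.isCentralExtensionOfL₁⟩
    · exact absurd rfl ht
    · exact ⟨CentralModel k 1, inferInstance, inferInstance, CentralModel.isCentralExtensionOfL₁⟩
    · exact ⟨DerivationModel k 1 0, inferInstance, inferInstance,
        DerivationModel.isDerivationExtensionOfL₁⟩
    · exact ⟨DerivationModel k 0 1, inferInstance, inferInstance,
        DerivationModel.isDerivationExtensionOfL₁⟩
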